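/- Let $\theta>0$. For $N\ge 1$, the Ewens measure with parameter $\theta$ on the symmetric group $S_N$ is the probability measure $$\mu_N(\{\sigma\})=\frac{\theta^{\#(\sigma)}}{\theta(\theta+1)\cdots(\theta+N-1)},\qquad \sigma\in S_N,$$ where $\#(\sigma)$ is the number of cycles of $\sigma$, fixed points included. For each $N$ let $\sigma_N$ be a random permutation with law $\mu_N$ (the $\sigma_N$ may be defined on different probability spaces), and let $$A^{(N)}=\#\{\,1\le i\le N-1 : \sigma_N(i+1)=\sigma_N(i)+1 \text{ or } \sigma_N(i+1)=\sigma_N(i)-1\,\}$$ be its number of adjacencies. Then, as $N\to\infty$, $A^{(N)}$ converges in distribution to a Poisson random variable with parameter $2$. -/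

import Mathlib

open MeasureTheory ProbabilityTheory Filter

namespace Ewens

/-- The symmetric group on `Fin N` is a finite set; it carries the discrete σ-algebra. -/
instance instMeasurableSpacePerm (N : ℕ) : MeasurableSpace (Equiv.Perm (Fin N)) := ⊤

instance instDiscreteMeasurableSpacePerm (N : ℕ) :
    DiscreteMeasurableSpace (Equiv.Perm (Fin N)) := ⟨fun _ => trivial⟩

/-- The number of cycles of a permutation, fixed points included: the number of
classes of the relation "being in the same cycle". -/
noncomputable def numCycles {N : ℕ} (σ : Equiv.Perm (Fin N)) : ℕ :=
  Nat.card (Quotient (Equiv.Perm.SameCycle.setoid σ))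

/-- The Ewens weight `θ ^ #(σ) / (θ (θ + 1) ⋯ (θ + N - 1))`. -/
noncomputable def ewensWeight (θ : ℝ) {N : ℕ} (σ : Equiv.Perm (Fin N)) : ℝ :=
  θ ^ numCycles σ / ∏ k ∈ Finset.range N, (θ + k)

/-- The Ewens measure with parameter `θ` on the symmetric group on `Fin N`. -/
noncomputable def ewensMeasure (θ : ℝ) (N : ℕ) : Measure (Equiv.Perm (Fin N)) :=
  ∑ σ : Equiv.Perm (Fin N), ENNReal.ofReal (ewensWeight θ σ) • Measure.dirac σ

/-- The number of adjacencies of `σ`: the number of positions `i` such that `i + 1` is also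
a position and `σ (i + 1) = σ i + 1` or `σ (i + 1) = σ i - 1` (as integers). -/
def numAdjacencies {N : ℕ} (σ : Equiv.Perm (Fin N)) : ℕ :=
  (Finset.univ.filter fun i : Fin N => ∃ h : (i : ℕ) + 1 < N,
    ((σ ⟨i + 1, h⟩ : ℕ) : ℤ) = ((σ i : ℕ) : ℤ) + 1 ∨
    ((σ ⟨i + 1, h⟩ : ℕ) : ℤ) = ((σ i : ℕ) : ℤ) - 1).card

theorem ewensMeasure_singleton (θ : ℝ) (N : ℕ) (σ : Equiv.Perm (Fin N)) :
    ewensMeasure θ N {σ} = ENNReal.ofReal (ewensWeight θ σ) := by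
  classical
  simp only [ewensMeasure, Measure.coe_finsetSum, Finset.sum_apply, Measure.smul_apply,
    Measure.dirac_apply, smul_eq_mul]
  rw [Finset.sum_eq_single σ]
  · simp
  · intro τ _ h
    simp [h]
  · simp

theorem eq_of_sameCycle {α β : Type*} {f : Equiv.Perm α} (r : α → β)
    (h : ∀ a, r (f a) = r a) {a b : α} (hab : f.SameCycle a b) : r a = r b := by
  obtain ⟨i, rfl⟩ := hab
  induction i with
  | zero => simp
  | succ n ih =>
    rw [ih, add_comm, zpow_add, zpow_one, Equiv.Perm.mul_apply, h]
  | pred n ih =>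
    rw [ih, ← h ((f ^ (-(n : ℤ) - 1)) a), ← Equiv.Perm.mul_apply, ← zpow_one_add]
    congr 3
    ring

theorem sameCycle_decomposeFin {N : ℕ} (p : Fin (N + 1)) (e : Equiv.Perm (Fin N)) {x y : Fin N}
    (h : e.SameCycle x y) :
    (Equiv.Perm.decomposeFin.symm (p, e)).SameCycle x.succ y.succ := by
  set f := Equiv.Perm.decomposeFin.symm (p, e) with hf
  let inst : Setoid (Fin (N + 1)) := Equiv.Perm.SameCycle.setoid f
  have key := eq_of_sameCycle (f := e) (fun x : Fin N => (⟦x.succ⟧ : Quotient inst)) (fun a => by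
    refine Quotient.sound ?_
    change f.SameCycle _ _
    by_cases hp : (e a).succ = p
    · have h1 : f a.succ = 0 := by simp [hf, hp]
      have h2 : f 0 = (e a).succ := by simp [hf, hp]
      rw [← h2, ← h1]
      simp [Equiv.Perm.SameCycle.refl]
    · have h1 : f a.succ = (e a).succ := by
        rw [hf, Equiv.Perm.decomposeFin_symm_apply_succ,
          Equiv.swap_apply_of_ne_of_ne (Fin.succ_ne_zero _) hp]
      rw [← h1]
      simp [Equiv.Perm.SameCycle.refl]) h
  exact Quotient.exact key

theorem numCycles_decomposeFin_zero {N : ℕ} (e : Equiv.Perm (Fin N)) :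
    numCycles (Equiv.Perm.decomposeFin.symm (0, e)) = numCycles e + 1 := by
  set f := Equiv.Perm.decomposeFin.symm ((0 : Fin (N + 1)), e) with hf
  let r : Fin (N + 1) → Option (Quotient (Equiv.Perm.SameCycle.setoid e)) :=
    Fin.cases none (fun x => some (Quotient.mk _ x))
  have hr : ∀ a, r (f a) = r a := by
    intro a
    refine Fin.cases ?_ (fun x => ?_) a
    · simp [hf]
    · simp only [hf, Equiv.Perm.decomposeFin_symm_apply_succ, Equiv.swap_self, Equiv.refl_apply]
      simp only [r, Fin.cases_succ, Option.some.injEq]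
      exact Quotient.sound (Equiv.Perm.sameCycle_apply_left.2 (Equiv.Perm.SameCycle.refl _ _))
  let R : Quotient (Equiv.Perm.SameCycle.setoid f) →
      Option (Quotient (Equiv.Perm.SameCycle.setoid e)) :=
    Quotient.lift r (fun a b h => eq_of_sameCycle r hr h)
  have hR : Function.Bijective R := by
    constructor
    · rintro ⟨a⟩ ⟨b⟩
      change r a = r b → _
      refine Fin.cases ?_ (fun x => ?_) a <;> refine Fin.cases ?_ (fun y => ?_) b
      · intro _; rfl
      · intro h; simp [r] at h
      · intro h; simp [r] at h
      · intro h
        simp only [r, Fin.cases_succ, Option.some.injEq] at h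
        exact Quotient.sound (sameCycle_decomposeFin 0 e (Quotient.exact h))
    · rintro (_ | ⟨⟨x⟩⟩)
      · exact ⟨Quotient.mk _ 0, rfl⟩
      · exact ⟨Quotient.mk _ x.succ, rfl⟩
  rw [numCycles, Nat.card_eq_of_bijective R hR, Finite.card_option, numCycles]

theorem numCycles_decomposeFin_succ {N : ℕ} (q : Fin N) (e : Equiv.Perm (Fin N)) :
    numCycles (Equiv.Perm.decomposeFin.symm (q.succ, e)) = numCycles e := by
  set f := Equiv.Perm.decomposeFin.symm (q.succ, e) with hf
  let r : Fin (N + 1) → Quotient (Equiv.Perm.SameCycle.setoid e) :=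
    Fin.cases (Quotient.mk _ q) (fun x => Quotient.mk _ x)
  have hr : ∀ a, r (f a) = r a := by
    intro a
    refine Fin.cases ?_ (fun x => ?_) a
    · simp [hf, r]
    · have hx : (Quotient.mk (Equiv.Perm.SameCycle.setoid e) (e x)) = Quotient.mk _ x :=
        Quotient.sound (Equiv.Perm.sameCycle_apply_left.2 (Equiv.Perm.SameCycle.refl _ _))
      rw [hf, Equiv.Perm.decomposeFin_symm_apply_succ]
      by_cases hp : e x = q
      · rw [hp, Equiv.swap_apply_right]
        simp only [r, Fin.cases_zero, Fin.cases_succ]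
        rw [← hx, hp]
      · rw [Equiv.swap_apply_of_ne_of_ne (Fin.succ_ne_zero _) (by simpa using hp)]
        exact hx
  let R : Quotient (Equiv.Perm.SameCycle.setoid f) → Quotient (Equiv.Perm.SameCycle.setoid e) :=
    Quotient.lift r (fun a b h => eq_of_sameCycle r hr h)
  have h0 : ∀ a : Fin (N + 1), ∃ x : Fin N, f.SameCycle a x.succ := by
    intro a
    refine Fin.cases ⟨q, 1, by simp [hf]⟩ (fun x => ⟨x, Equiv.Perm.SameCycle.refl _ _⟩) a
  have hR : Function.Bijective R := by
    constructor
    · rintro ⟨a⟩ ⟨b⟩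
      obtain ⟨x, hx⟩ := h0 a
      obtain ⟨y, hy⟩ := h0 b
      change r a = r b → _
      rw [eq_of_sameCycle r hr hx, eq_of_sameCycle r hr hy]
      intro h
      exact Quotient.sound (hx.trans ((sameCycle_decomposeFin q.succ e
        (Quotient.exact h)).trans hy.symm))
    · rintro ⟨x⟩
      exact ⟨Quotient.mk _ x.succ, rfl⟩
  rw [numCycles, Nat.card_eq_of_bijective R hR, numCycles]

theorem sum_pow_numCycles (θ : ℝ) (N : ℕ) :
    ∑ σ : Equiv.Perm (Fin N), θ ^ numCycles σ = ∏ k ∈ Finset.range N, (θ + k) := by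
  induction N with
  | zero => simp [numCycles]
  | succ N ih =>
    rw [Finset.prod_range_succ, ← ih, ← Equiv.sum_comp Equiv.Perm.decomposeFin.symm,
      Fintype.sum_prod_type, Fin.sum_univ_succ]
    simp only [numCycles_decomposeFin_zero, numCycles_decomposeFin_succ, pow_succ,
      Finset.sum_const, Finset.card_univ, Fintype.card_fin, nsmul_eq_mul, ← Finset.sum_mul]
    ring

theorem isProbabilityMeasure_ewensMeasure {θ : ℝ} (hθ : 0 < θ) (N : ℕ) :
    IsProbabilityMeasure (ewensMeasure θ N) := by
  constructor
  have hpos : 0 < ∏ k ∈ Finset.range N, (θ + (k : ℝ)) :=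
    Finset.prod_pos fun k _ => by positivity
  simp only [ewensMeasure, Measure.coe_finsetSum, Finset.sum_apply, Measure.smul_apply,
    measure_univ, smul_eq_mul, mul_one]
  have hw : ∀ σ ∈ (Finset.univ : Finset (Equiv.Perm (Fin N))), 0 ≤ ewensWeight θ σ :=
    fun σ _ => div_nonneg (pow_nonneg hθ.le _) hpos.le
  rw [← ENNReal.ofReal_sum_of_nonneg hw]
  simp only [ewensWeight, ← Finset.sum_div, sum_pow_numCycles]
  rw [div_self hpos.ne', ENNReal.ofReal_one]

end Ewens

namespace Ewens

/-! An Ewens permutation of size N + 1 arises from one of size N by the Chinese restaurant rule: a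
new smallest element is made a fixed point with probability θ/(θ + N), or inserted after j in its
cycle with probability 1/(θ + N) for each j (`ewensExp_succ`). In one-line notation, insertion after
j raises all values by one, writes 0 in place of the entry at j and moves the displaced entry to the
front. Summed over j, the destroyed adjacencies number 2A (`sum_lostAt`), and the created ones 4 up
to boundary terms (`sum_gainedAt`). With s = 1/(θ + N), the count A is thus close to a birth and
death chain with death rate 2sa and birth rate 4s, for which Poisson(2) is stationary.

The errors come from boundary coincidences and from insertions that change several adjacencies at
once. A transposition changes the number of cycles by at most one, hence the weight by a bounded
factor, so values at distinct positions are nearly as spread out as under the uniform law. The error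
per step is then O(1/N²), which is summable (`abs_ewensExp_numAdjacencies_succ_sub_le`).

On f_u(a) = e^{2u}(1 - u)^a the generator acts as -2u ∂/∂u, so one step replaces u by u(1 - 2s) up
to O(1/N²) (`abs_testExp_succ_sub_le`). Going back from a large n to a fixed m drives u to 0, where
f_0 = 1; hence E f_u(A) → 1, that is E(1 - u)^A → e^{-2u} (`tendsto_testExp`). Generating functions
determine the limits of point masses, and Fatou's lemma with the portmanteau theorem gives
convergence in law. -/

/-! ### Transpositions and the Ewens weight -/

theorem numCycles_le_numCycles_mul_swap {N : ℕ} (e : Equiv.Perm (Fin N)) (a b : Fin N) :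
    numCycles e ≤ numCycles (e * Equiv.swap a b) + 1 := by
  classical
  set t := e * Equiv.swap a b with ht
  let Q := Quotient (Equiv.Perm.SameCycle.setoid e)
  let cls : Fin N → Q := Quotient.mk _
  have hcls : ∀ x, cls (e x) = cls x := fun x =>
    Quotient.sound (Equiv.Perm.sameCycle_apply_left.2 (Equiv.Perm.SameCycle.refl _ _))
  -- Once the cycles of a and b are identified, the class of a point is invariant under `t`. The
  -- classes of `t` therefore reach every class of `e` except possibly that of b, which `none`
  -- supplies.
  let glue : Q → Q := fun c => if c = cls b then cls a else c
  have hab : glue (cls a) = glue (cls b) := by simp [glue]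
  have hinv : ∀ x, glue (cls (t x)) = glue (cls x) := by
    intro x
    rw [ht, Equiv.Perm.mul_apply, hcls]
    by_cases hxa : x = a
    · rw [hxa, Equiv.swap_apply_left, hab]
    by_cases hxb : x = b
    · rw [hxb, Equiv.swap_apply_right, hab]
    rw [Equiv.swap_apply_of_ne_of_ne hxa hxb]
  let R : Quotient (Equiv.Perm.SameCycle.setoid t) → Q :=
    Quotient.lift (fun x => glue (cls x)) (fun x y h => eq_of_sameCycle (f := t) (fun x => glue (cls x)) hinv h)
  let R' : Option (Quotient (Equiv.Perm.SameCycle.setoid t)) → Q := fun o => o.elim (cls b) R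
  have hR' : Function.Surjective R' := by
    rintro ⟨x⟩
    by_cases hx : cls x = cls b
    · exact ⟨none, hx.symm⟩
    · exact ⟨some (Quotient.mk _ x), if_neg hx⟩
  have := Nat.card_le_card_of_surjective R' hR'
  rwa [Finite.card_option] at this

/-- The largest factor by which a transposition can change the Ewens weight. -/
noncomputable def swapFactor (θ : ℝ) : ℝ := max θ θ⁻¹

theorem swapFactor_pos {θ : ℝ} (hθ : 0 < θ) : 0 < swapFactor θ := lt_max_of_lt_left hθ

theorem one_le_swapFactor {θ : ℝ} (hθ : 0 < θ) : 1 ≤ swapFactor θ := by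
  rcases le_total 1 θ with h | h
  · exact h.trans (le_max_left _ _)
  · exact ((one_le_inv₀ hθ).2 h).trans (le_max_right _ _)

theorem ewensWeight_nonneg {θ : ℝ} (hθ : 0 < θ) {N : ℕ} (σ : Equiv.Perm (Fin N)) :
    0 ≤ ewensWeight θ σ :=
  div_nonneg (pow_nonneg hθ.le _) (Finset.prod_nonneg fun k _ => by positivity)

theorem ewensWeight_le_mul_swap {θ : ℝ} (hθ : 0 < θ) {N : ℕ} (σ : Equiv.Perm (Fin N))
    (a b : Fin N) :
    ewensWeight θ σ ≤ swapFactor θ * ewensWeight θ (σ * Equiv.swap a b) := by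
  have h1 := numCycles_le_numCycles_mul_swap σ a b
  -- The swap is an involution, so the one-sided bound also gives the reverse one.
  have h2 := numCycles_le_numCycles_mul_swap (σ * Equiv.swap a b) a b
  rw [mul_assoc, Equiv.swap_mul_self, mul_one] at h2
  have hprod : 0 ≤ ∏ k ∈ Finset.range N, (θ + (k : ℝ)) :=
    Finset.prod_nonneg fun k _ => by positivity
  rw [ewensWeight, ewensWeight, ← mul_div_assoc]
  refine div_le_div_of_nonneg_right ?_ hprod
  set m := numCycles (σ * Equiv.swap a b)
  have hm : 0 ≤ θ ^ m := pow_nonneg hθ.le _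
  have hcases : numCycles σ = m + 1 ∨ numCycles σ = m ∨ numCycles σ + 1 = m := by omega
  rcases hcases with h | h | h
  · rw [h, pow_succ, mul_comm]
    exact mul_le_mul_of_nonneg_right (le_max_left _ _) hm
  · rw [h]
    exact le_mul_of_one_le_left hm (one_le_swapFactor hθ)
  · have : θ ^ numCycles σ = θ⁻¹ * θ ^ m := by
      rw [← h, pow_succ]; field_simp
    rw [this]
    exact mul_le_mul_of_nonneg_right (le_max_right _ _) hm

/-! ### Expectation and probability under the Ewens measure -/

/-- Expectation under the Ewens measure. -/
noncomputable def ewensExp (θ : ℝ) {N : ℕ} (f : Equiv.Perm (Fin N) → ℝ) : ℝ :=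
  ∑ σ, ewensWeight θ σ * f σ

/-- Probability of an event under the Ewens measure. -/
noncomputable def ewensProb (θ : ℝ) {N : ℕ} (B : Set (Equiv.Perm (Fin N))) : ℝ :=
  ewensExp θ (B.indicator 1)

theorem ewensExp_mono {θ : ℝ} (hθ : 0 < θ) {N : ℕ} {f g : Equiv.Perm (Fin N) → ℝ}
    (h : ∀ σ, f σ ≤ g σ) : ewensExp θ f ≤ ewensExp θ g :=
  Finset.sum_le_sum fun σ _ => mul_le_mul_of_nonneg_left (h σ) (ewensWeight_nonneg hθ σ)

theorem ewensExp_add (θ : ℝ) {N : ℕ} (f g : Equiv.Perm (Fin N) → ℝ) :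
    ewensExp θ (fun σ => f σ + g σ) = ewensExp θ f + ewensExp θ g := by
  simp [ewensExp, mul_add, Finset.sum_add_distrib]

theorem ewensExp_sub (θ : ℝ) {N : ℕ} (f g : Equiv.Perm (Fin N) → ℝ) :
    ewensExp θ (fun σ => f σ - g σ) = ewensExp θ f - ewensExp θ g := by
  simp [ewensExp, mul_sub, Finset.sum_sub_distrib]

theorem ewensExp_const_mul (θ c : ℝ) {N : ℕ} (f : Equiv.Perm (Fin N) → ℝ) :
    ewensExp θ (fun σ => c * f σ) = c * ewensExp θ f := by
  simp only [ewensExp, Finset.mul_sum]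
  exact Finset.sum_congr rfl fun σ _ => by ring

theorem ewensExp_sum (θ : ℝ) {N : ℕ} {ι : Type*} (s : Finset ι)
    (f : ι → Equiv.Perm (Fin N) → ℝ) :
    ewensExp θ (fun σ => ∑ i ∈ s, f i σ) = ∑ i ∈ s, ewensExp θ (f i) := by
  simp only [ewensExp, Finset.mul_sum]
  exact Finset.sum_comm

theorem ewensExp_const {θ : ℝ} (hθ : 0 < θ) (N : ℕ) (c : ℝ) :
    ewensExp θ (fun _ : Equiv.Perm (Fin N) => c) = c := by
  have hpos : 0 < ∏ k ∈ Finset.range N, (θ + (k : ℝ)) :=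
    Finset.prod_pos fun k _ => by positivity
  simp only [ewensExp, ← Finset.sum_mul, ewensWeight, ← Finset.sum_div, sum_pow_numCycles]
  rw [div_self hpos.ne', one_mul]

theorem abs_ewensExp_le {θ : ℝ} (hθ : 0 < θ) {N : ℕ} {f g : Equiv.Perm (Fin N) → ℝ}
    (h : ∀ σ, |f σ| ≤ g σ) : |ewensExp θ f| ≤ ewensExp θ g := by
  refine (Finset.abs_sum_le_sum_abs _ _).trans (Finset.sum_le_sum fun σ _ => ?_)
  rw [abs_mul, abs_of_nonneg (ewensWeight_nonneg hθ σ)]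
  exact mul_le_mul_of_nonneg_left (h σ) (ewensWeight_nonneg hθ σ)

theorem ewensProb_nonneg {θ : ℝ} (hθ : 0 < θ) {N : ℕ} (B : Set (Equiv.Perm (Fin N))) :
    0 ≤ ewensProb θ B :=
  Finset.sum_nonneg fun σ _ => mul_nonneg (ewensWeight_nonneg hθ σ)
    (Set.indicator_nonneg (fun _ _ => zero_le_one) _)

theorem ewensProb_mono {θ : ℝ} (hθ : 0 < θ) {N : ℕ} {B C : Set (Equiv.Perm (Fin N))}
    (h : B ⊆ C) : ewensProb θ B ≤ ewensProb θ C :=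
  ewensExp_mono hθ fun _ => Set.indicator_le_indicator_of_subset h (fun _ => zero_le_one) _

theorem ewensProb_univ {θ : ℝ} (hθ : 0 < θ) (N : ℕ) :
    ewensProb θ (Set.univ : Set (Equiv.Perm (Fin N))) = 1 := by
  rw [ewensProb, Set.indicator_univ]
  exact ewensExp_const hθ N 1

theorem ewensProb_empty (θ : ℝ) (N : ℕ) :
    ewensProb θ (∅ : Set (Equiv.Perm (Fin N))) = 0 := by
  simp [ewensProb, ewensExp]

theorem ewensProb_union_le {θ : ℝ} (hθ : 0 < θ) {N : ℕ} (B C : Set (Equiv.Perm (Fin N))) :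
    ewensProb θ (B ∪ C) ≤ ewensProb θ B + ewensProb θ C := by
  classical
  rw [ewensProb, ewensProb, ewensProb, ← ewensExp_add]
  refine ewensExp_mono hθ fun σ => ?_
  by_cases h1 : σ ∈ B <;> by_cases h2 : σ ∈ C <;> simp [h1, h2]

theorem ewensProb_union_le_add {θ : ℝ} (hθ : 0 < θ) {N : ℕ} {B C : Set (Equiv.Perm (Fin N))}
    {b c : ℝ} (hB : ewensProb θ B ≤ b) (hC : ewensProb θ C ≤ c) : ewensProb θ (B ∪ C) ≤ b + c :=
  (ewensProb_union_le hθ B C).trans (add_le_add hB hC)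

/-! ### Approximate exchangeability of the values -/

/-- If `B` and `T` only depend on the values of the permutation on `X`, then the value at a
further position lies in `T` with conditional probability at most of order `m / N`. -/
theorem ewensProb_value_mem_le {θ : ℝ} (hθ : 0 < θ) {N : ℕ} (X : Finset (Fin N)) (x : Fin N)
    (hx : x ∉ X) (B : Set (Equiv.Perm (Fin N))) (T : Equiv.Perm (Fin N) → Finset (Fin N)) (m : ℕ)
    (hB : ∀ e e' : Equiv.Perm (Fin N), (∀ i ∈ X, e i = e' i) → e ∈ B → e' ∈ B)
    (hT : ∀ e e' : Equiv.Perm (Fin N), (∀ i ∈ X, e i = e' i) → T e = T e')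
    (hm : ∀ e, (T e).card ≤ m) :
    ((N : ℝ) - X.card) * ewensProb θ {e | e ∈ B ∧ e x ∈ T e} ≤
      swapFactor θ * m * ewensProb θ B := by
  classical
  have hX : ((Finset.univ \ X).card : ℝ) = (N : ℝ) - X.card := by
    rw [Finset.card_sdiff_of_subset (Finset.subset_univ X), Nat.cast_sub (Finset.card_le_card (Finset.subset_univ X)),
      Finset.card_univ, Fintype.card_fin]
  -- Exchanging positions x and y leaves the values on X alone, hence also B and T, and costs one
  -- factor `swapFactor θ`. Averaging over all y outside X then reduces the bound to counting the
  -- positions whose value lies in T.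
  have hstep : ∀ y ∈ Finset.univ \ X,
      ewensProb θ {e | e ∈ B ∧ e x ∈ T e} ≤
        swapFactor θ * ewensProb θ {e | e ∈ B ∧ e y ∈ T e} := by
    intro y hy
    have hy' : y ∉ X := by simpa using hy
    rw [ewensProb, ewensProb, ewensExp, ewensExp,
      ← Equiv.sum_comp (Equiv.mulRight (Equiv.swap x y)) (fun σ => ewensWeight θ σ *
        Set.indicator {e : Equiv.Perm (Fin N) | e ∈ B ∧ e y ∈ T e} 1 σ), Finset.mul_sum]
    refine Finset.sum_le_sum fun σ _ => ?_
    simp only [Equiv.coe_mulRight]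
    have hagree : ∀ i ∈ X, σ i = (σ * Equiv.swap x y) i := by
      intro i hi
      rw [Equiv.Perm.mul_apply, Equiv.swap_apply_of_ne_of_ne]
      · rintro rfl; exact hx hi
      · rintro rfl; exact hy' hi
    by_cases h : σ ∈ B ∧ σ x ∈ T σ
    · have h' : (σ * Equiv.swap x y) ∈ {e : Equiv.Perm (Fin N) | e ∈ B ∧ e y ∈ T e} := by
        refine ⟨hB _ _ hagree h.1, ?_⟩
        rw [← hT _ _ hagree, Equiv.Perm.mul_apply, Equiv.swap_apply_right]
        exact h.2
      rw [Set.indicator_of_mem h', Set.indicator_of_mem (by exact h)]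
      simpa using ewensWeight_le_mul_swap hθ σ x y
    · rw [Set.indicator_of_notMem (by exact h), mul_zero]
      exact mul_nonneg (swapFactor_pos hθ).le (mul_nonneg (ewensWeight_nonneg hθ _)
        (Set.indicator_nonneg (fun _ _ => zero_le_one) _))
  calc ((N : ℝ) - X.card) * ewensProb θ {e | e ∈ B ∧ e x ∈ T e}
      = ∑ _y ∈ Finset.univ \ X, ewensProb θ {e | e ∈ B ∧ e x ∈ T e} := by
        rw [Finset.sum_const, nsmul_eq_mul, hX]
    _ ≤ ∑ y ∈ Finset.univ \ X, swapFactor θ * ewensProb θ {e | e ∈ B ∧ e y ∈ T e} :=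
        Finset.sum_le_sum hstep
    _ ≤ ∑ y, swapFactor θ * ewensProb θ {e | e ∈ B ∧ e y ∈ T e} :=
        Finset.sum_le_sum_of_subset_of_nonneg (Finset.subset_univ _) fun _ _ _ =>
          mul_nonneg (swapFactor_pos hθ).le (ewensProb_nonneg hθ _)
    _ = swapFactor θ * ewensExp θ (fun e => ∑ y,
          Set.indicator {e : Equiv.Perm (Fin N) | e ∈ B ∧ e y ∈ T e} 1 e) := by
        rw [ewensExp_sum, ← Finset.mul_sum]; rfl
    _ ≤ swapFactor θ * ewensExp θ (fun e => m * B.indicator 1 e) := by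
        refine mul_le_mul_of_nonneg_left (ewensExp_mono hθ fun e => ?_) (swapFactor_pos hθ).le
        by_cases he : e ∈ B
        · have h1 : ∀ y, Set.indicator {e : Equiv.Perm (Fin N) | e ∈ B ∧ e y ∈ T e}
              (1 : Equiv.Perm (Fin N) → ℝ) e = if e y ∈ T e then 1 else 0 := by
            intro y; simp [Set.indicator_apply, he]
          simp only [h1, Set.indicator_of_mem he, Pi.one_apply, mul_one]
          rw [Equiv.sum_comp e (fun y => if y ∈ T e then (1 : ℝ) else 0)]
          simpa using hm e
        · simp [he]
    _ = swapFactor θ * m * ewensProb θ B := by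
        rw [ewensExp_const_mul, ewensProb]; ring

theorem ewensProb_value_mem_le_div {θ : ℝ} (hθ : 0 < θ) {N : ℕ} (hN : 3 ≤ N)
    (X : Finset (Fin N)) (hXc : X.card ≤ 2) (x : Fin N)
    (hx : x ∉ X) (B : Set (Equiv.Perm (Fin N))) (T : Equiv.Perm (Fin N) → Finset (Fin N)) (m : ℕ)
    (hB : ∀ e e' : Equiv.Perm (Fin N), (∀ i ∈ X, e i = e' i) → e ∈ B → e' ∈ B)
    (hT : ∀ e e' : Equiv.Perm (Fin N), (∀ i ∈ X, e i = e' i) → T e = T e')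
    (hm : ∀ e, (T e).card ≤ m) :
    ewensProb θ {e | e ∈ B ∧ e x ∈ T e} ≤ 3 * swapFactor θ * m / N * ewensProb θ B := by
  have h := ewensProb_value_mem_le hθ X x hx B T m hB hT hm
  have hN' : (3 : ℝ) ≤ N := by exact_mod_cast hN
  have hXc' : (X.card : ℝ) ≤ 2 := by exact_mod_cast hXc
  have hp := ewensProb_nonneg hθ {e | e ∈ B ∧ e x ∈ T e}
  rw [div_mul_eq_mul_div, le_div_iff₀ (by linarith)]
  -- N - |X| ≥ N - 2 ≥ N/3, by N ≥ 3.
  have : (N : ℝ) / 3 * ewensProb θ {e | e ∈ B ∧ e x ∈ T e} ≤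
      ((N : ℝ) - X.card) * ewensProb θ {e | e ∈ B ∧ e x ∈ T e} :=
    mul_le_mul_of_nonneg_right (by linarith) hp
  linarith


/-! ### Adjacencies before and after an insertion -/

/-- The value of `e` at position `i`, as an integer; a junk value `-5` off the range. -/
def valueAt {N : ℕ} (e : Equiv.Perm (Fin N)) (i : ℕ) : ℤ :=
  if h : i < N then ((e ⟨i, h⟩ : ℕ) : ℤ) else -5

/-- The indicator of two integers being neighbours. -/
def adjInd (x y : ℤ) : ℤ := if y = x + 1 ∨ y = x - 1 then 1 else 0

/-- The indicator of an integer being zero. -/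
def zeroInd (x : ℤ) : ℤ := if x = 0 then 1 else 0

theorem valueAt_of_lt {N : ℕ} (e : Equiv.Perm (Fin N)) {i : ℕ} (h : i < N) :
    valueAt e i = ((e ⟨i, h⟩ : ℕ) : ℤ) := dif_pos h

theorem valueAt_of_le {N : ℕ} (e : Equiv.Perm (Fin N)) {i : ℕ} (h : N ≤ i) :
    valueAt e i = -5 := dif_neg (by omega)

theorem valueAt_fin {N : ℕ} (e : Equiv.Perm (Fin N)) (i : Fin N) :
    valueAt e i = ((e i : ℕ) : ℤ) := dif_pos i.2

theorem valueAt_nonneg {N : ℕ} (e : Equiv.Perm (Fin N)) {i : ℕ} (h : i < N) :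
    0 ≤ valueAt e i := by rw [valueAt_of_lt e h]; positivity

theorem numAdjacencies_eq_sum {n : ℕ} (e : Equiv.Perm (Fin (n + 1))) :
    (numAdjacencies e : ℤ) =
      ∑ i ∈ Finset.range n, adjInd (valueAt e i) (valueAt e (i + 1)) := by
  have h1 : (numAdjacencies e : ℤ) =
      ∑ i : Fin (n + 1), adjInd (valueAt e i) (valueAt e (i + 1)) := by
    rw [numAdjacencies, Finset.card_filter, Nat.cast_sum]
    refine Finset.sum_congr rfl fun i _ => ?_
    by_cases h : (i : ℕ) + 1 < n + 1
    · simp only [adjInd, valueAt_of_lt e h, valueAt_fin e i, h, exists_true_left]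
      push_cast
      rfl
    · have h2 := valueAt_nonneg e i.2
      have h3 := valueAt_of_le e (i := (i : ℕ) + 1) (by omega)
      -- The junk value -5 is not next to any nonnegative integer, so the last position contributes
      -- nothing.
      rw [if_neg (by rintro ⟨h', _⟩; exact h h'), adjInd, if_neg (by omega)]
      rfl
  rw [h1, Fin.sum_univ_eq_sum_range (fun i => adjInd (valueAt e i) (valueAt e (i + 1))),
    Finset.sum_range_succ, add_eq_left]
  have h2 := valueAt_nonneg e (Nat.lt_succ_self n)
  have h3 := valueAt_of_le e (le_refl (n + 1))
  rw [adjInd, if_neg (by omega)]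

/-- Insert a new smallest element as a fixed point. -/
def insertFixed {n : ℕ} (e : Equiv.Perm (Fin (n + 1))) : Equiv.Perm (Fin (n + 2)) :=
  Equiv.Perm.decomposeFin.symm (0, e)

/-- Insert a new smallest element right after `j` in its cycle. -/
def insertAfter {n : ℕ} (e : Equiv.Perm (Fin (n + 1))) (j : Fin (n + 1)) :
    Equiv.Perm (Fin (n + 2)) :=
  Equiv.Perm.decomposeFin.symm ((e j).succ, e)

theorem valueAt_insertFixed_zero {n : ℕ} (e : Equiv.Perm (Fin (n + 1))) :
    valueAt (insertFixed e) 0 = 0 := by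
  rw [valueAt_of_lt _ (by omega)]
  change (((Equiv.Perm.decomposeFin.symm (0, e) 0 : Fin (n + 2)) : ℕ) : ℤ) = 0
  simp

theorem valueAt_insertFixed_succ {n : ℕ} (e : Equiv.Perm (Fin (n + 1))) {i : ℕ}
    (hi : i < n + 1) : valueAt (insertFixed e) (i + 1) = valueAt e i + 1 := by
  rw [valueAt_of_lt _ (by omega), valueAt_of_lt _ hi]
  change (((Equiv.Perm.decomposeFin.symm (0, e) (Fin.succ ⟨i, hi⟩) : Fin (n + 2)) : ℕ) : ℤ) = _
  rw [Equiv.Perm.decomposeFin_symm_apply_succ]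
  simp

theorem valueAt_insertAfter_zero {n : ℕ} (e : Equiv.Perm (Fin (n + 1))) (j : Fin (n + 1)) :
    valueAt (insertAfter e j) 0 = valueAt e j + 1 := by
  rw [valueAt_of_lt _ (by omega), valueAt_fin]
  change (((Equiv.Perm.decomposeFin.symm ((e j).succ, e) 0 : Fin (n + 2)) : ℕ) : ℤ) = _
  simp

theorem valueAt_insertAfter_succ {n : ℕ} (e : Equiv.Perm (Fin (n + 1))) (j : Fin (n + 1)) {i : ℕ}
    (hi : i < n + 1) :
    valueAt (insertAfter e j) (i + 1) = if i = j then 0 else valueAt e i + 1 := by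
  rw [valueAt_of_lt _ (by omega), valueAt_of_lt _ hi]
  change (((Equiv.Perm.decomposeFin.symm ((e j).succ, e) (Fin.succ ⟨i, hi⟩) :
    Fin (n + 2)) : ℕ) : ℤ) = _
  rw [Equiv.Perm.decomposeFin_symm_apply_succ]
  by_cases h : i = j
  · have : (⟨i, hi⟩ : Fin (n + 1)) = j := Fin.ext h
    rw [this, Equiv.swap_apply_right, if_pos h]
    simp
  · have : (⟨i, hi⟩ : Fin (n + 1)) ≠ j := fun h' => h (congrArg Fin.val h')
    rw [Equiv.swap_apply_of_ne_of_ne (Fin.succ_ne_zero _)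
      (fun h' => this (e.injective (Fin.succ_injective _ h'))), if_neg h]
    simp

theorem sum_range_adjacent {n : ℕ} (g : ℕ → ℤ) {j : ℕ} (hj : j ≤ n) :
    ∑ i ∈ Finset.range n, (if i = j then g i else 0) = (if j < n then g j else 0) ∧
    ∑ i ∈ Finset.range n, (if i + 1 = j then g i else 0) = (if 0 < j then g (j - 1) else 0) := by
  constructor
  · rw [Finset.sum_ite_eq' (Finset.range n) j g]
    simp
  · rcases j with _ | j
    · simp
    · simp only [Nat.add_right_cancel_iff]
      rw [Finset.sum_ite_eq' (Finset.range n) j g, if_pos (by simp; omega)]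
      simp

/-- The number of adjacencies involving position `j`. -/
def lostAt {n : ℕ} (e : Equiv.Perm (Fin (n + 1))) (j : ℕ) : ℤ :=
  (if j < n then adjInd (valueAt e j) (valueAt e (j + 1)) else 0) +
  (if 0 < j then adjInd (valueAt e (j - 1)) (valueAt e j) else 0)

/-- The number of adjacencies created when inserting a new smallest element after `j`. -/
def gainedAt {n : ℕ} (e : Equiv.Perm (Fin (n + 1))) (j : ℕ) : ℤ :=
  (if j < n then zeroInd (valueAt e (j + 1)) else 0) +
  (if 0 < j then zeroInd (valueAt e (j - 1)) else 0) +
  (if j = 0 then zeroInd (valueAt e 0) else adjInd (valueAt e 0) (valueAt e j))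

theorem numAdjacencies_insertFixed {n : ℕ} (e : Equiv.Perm (Fin (n + 1))) :
    (numAdjacencies (insertFixed e) : ℤ) = numAdjacencies e + zeroInd (valueAt e 0) := by
  rw [numAdjacencies_eq_sum, numAdjacencies_eq_sum, Finset.sum_range_succ',
    valueAt_insertFixed_zero, valueAt_insertFixed_succ e (by omega)]
  congr 1
  · refine Finset.sum_congr rfl fun i hi => ?_
    rw [Finset.mem_range] at hi
    rw [valueAt_insertFixed_succ e (by omega), valueAt_insertFixed_succ e (by omega)]
    simp only [adjInd]
    congr 1
    apply propext; omega
  · have := valueAt_nonneg e (Nat.succ_pos n)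
    simp only [adjInd, zeroInd]
    congr 1
    apply propext; omega

/-- A common shift of values preserves adjacency, so only pairs meeting the entry at j or the new
front entry matter. The new 0 is adjacent to a neighbouring entry exactly when that entry was 0
before the shift. The displaced entry now precedes the old entry at position 0, or precedes the new
0 when j = 0. -/
theorem numAdjacencies_insertAfter {n : ℕ} (e : Equiv.Perm (Fin (n + 1))) (j : Fin (n + 1)) :
    (numAdjacencies (insertAfter e j) : ℤ) =
      numAdjacencies e - lostAt e j + gainedAt e j := by
  have hj : (j : ℕ) ≤ n := by omega
  obtain ⟨s1, s2⟩ := sum_range_adjacent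
    (fun i => adjInd (valueAt e i) (valueAt e (i + 1))) hj
  have s3 := (sum_range_adjacent (fun i => zeroInd (valueAt e (i + 1))) hj).1
  have s4 := (sum_range_adjacent (fun i => zeroInd (valueAt e i)) hj).2
  have hterm : ∀ i ∈ Finset.range n,
      adjInd (valueAt (insertAfter e j) (i + 1)) (valueAt (insertAfter e j) (i + 1 + 1)) =
      adjInd (valueAt e i) (valueAt e (i + 1)) -
        ((if i = j then adjInd (valueAt e i) (valueAt e (i + 1)) else 0) +
          (if i + 1 = j then adjInd (valueAt e i) (valueAt e (i + 1)) else 0)) +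
        ((if i = j then zeroInd (valueAt e (i + 1)) else 0) +
          (if i + 1 = j then zeroInd (valueAt e i) else 0)) := by
    intro i hi
    rw [Finset.mem_range] at hi
    rw [valueAt_insertAfter_succ e j (by omega), valueAt_insertAfter_succ e j (by omega)]
    have h1 := valueAt_nonneg e (i := i) (by omega)
    have h2 := valueAt_nonneg e (i := i + 1) (by omega)
    by_cases hij : i = j
    · have : i + 1 ≠ j := by omega
      simp only [hij, if_true, if_neg (show ((j : ℕ) + 1 ≠ j) by omega)]
      rw [hij] at h2
      simp only [adjInd, zeroInd]
      split_ifs <;> omega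
    · by_cases hij' : i + 1 = j
      · simp only [hij, hij', if_true, if_false]
        simp only [adjInd, zeroInd]
        split_ifs <;> omega
      · simp only [hij, hij', if_false]
        simp only [adjInd]
        split_ifs <;> omega
  rw [numAdjacencies_eq_sum, numAdjacencies_eq_sum, Finset.sum_range_succ',
    Finset.sum_congr rfl hterm, Finset.sum_add_distrib, Finset.sum_sub_distrib,
    Finset.sum_add_distrib, Finset.sum_add_distrib, s1, s2, s3, s4,
    valueAt_insertAfter_zero, valueAt_insertAfter_succ e j (by omega)]
  have hlast : adjInd (valueAt e j + 1) (if 0 = (j : ℕ) then 0 else valueAt e 0 + 1) =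
      if (j : ℕ) = 0 then zeroInd (valueAt e 0) else adjInd (valueAt e 0) (valueAt e j) := by
    have h0 := valueAt_nonneg e (Nat.succ_pos n)
    by_cases h : (j : ℕ) = 0
    · rw [if_pos h.symm, if_pos h, h]
      simp only [adjInd, zeroInd]
      split_ifs <;> omega
    · rw [if_neg (Ne.symm h), if_neg h]
      simp only [adjInd]
      split_ifs <;> omega
  rw [hlast, lostAt, gainedAt]
  rcases Nat.eq_zero_or_pos (j : ℕ) with h | h
  · simp only [h, lt_irrefl, if_false]; ring
  · have : (j : ℕ) - 1 + 1 = j := by omega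
    simp only [this]; ring

/-! ### Totals over all insertion places -/

theorem sum_ite_lt_add_ite_pos (n : ℕ) (f g : ℕ → ℤ) :
    ∑ j ∈ Finset.range (n + 1), ((if j < n then f j else 0) + (if 0 < j then g (j - 1) else 0)) =
      ∑ j ∈ Finset.range n, (f j + g j) := by
  rw [Finset.sum_add_distrib, Finset.sum_add_distrib, Finset.sum_range_succ,
    Finset.sum_range_succ' _ n]
  simp only [lt_irrefl, if_false, add_zero, Nat.succ_pos, if_true, Nat.add_sub_cancel]
  congr 1
  exact Finset.sum_congr rfl fun i hi => if_pos (Finset.mem_range.1 hi)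

/-- Each adjacency is counted once by each of its two positions. -/
theorem sum_lostAt {n : ℕ} (e : Equiv.Perm (Fin (n + 1))) :
    ∑ j : Fin (n + 1), lostAt e j = 2 * numAdjacencies e := by
  rw [Fin.sum_univ_eq_sum_range (fun j => lostAt e j), numAdjacencies_eq_sum, Finset.mul_sum]
  have := sum_ite_lt_add_ite_pos n (fun j => adjInd (valueAt e j) (valueAt e (j + 1)))
    (fun j => adjInd (valueAt e j) (valueAt e (j + 1)))
  refine Eq.trans (Finset.sum_congr rfl fun j _ => ?_)
    (this.trans (Finset.sum_congr rfl fun j _ => by ring))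
  rcases j with _ | j <;> simp [lostAt]

theorem sum_comp_valueAt {N : ℕ} (e : Equiv.Perm (Fin N)) (f : ℤ → ℤ) :
    ∑ j ∈ Finset.range N, f (valueAt e j) = ∑ v ∈ Finset.range N, f v := by
  rw [← Fin.sum_univ_eq_sum_range (fun j => f (valueAt e j)),
    ← Fin.sum_univ_eq_sum_range (fun j => f (j : ℤ)),
    ← Equiv.sum_comp e (fun v => f ((v : ℕ) : ℤ))]
  exact Finset.sum_congr rfl fun j _ => by rw [valueAt_fin]

theorem sum_zeroInd_range (n : ℕ) : ∑ v ∈ Finset.range (n + 1), zeroInd v = 1 := by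
  rw [Finset.sum_range_succ']
  simp [zeroInd]
  intro i _; omega

theorem sum_adjInd_range (n : ℕ) {a : ℕ} (ha : a ≤ n) :
    ∑ v ∈ Finset.range (n + 1), adjInd a v =
      2 - (if a = 0 then 1 else 0) - (if a = n then 1 else 0) := by
  have : ∀ v ∈ Finset.range (n + 1), adjInd a v =
      (if v = a + 1 then 1 else 0) + (if 0 < a then (if v = a - 1 then 1 else 0) else 0) := by
    intro v _
    simp only [adjInd]
    split_ifs <;> omega
  rw [Finset.sum_congr rfl this, Finset.sum_add_distrib, Finset.sum_ite_eq']
  by_cases h : 0 < a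
  · simp only [h, if_true]
    rw [Finset.sum_ite_eq']
    simp only [Finset.mem_range]
    split_ifs <;> omega
  · simp only [h, if_false, Finset.sum_const_zero, Finset.mem_range]
    split_ifs <;> omega

/-- The value 0 has two neighbouring positions unless it stands at an end, and the value at position
0 has two neighbouring values unless it is 0 or n. The special term at j = 0 cancels one of the two
corrections for a leading 0. -/
theorem sum_gainedAt {n : ℕ} (e : Equiv.Perm (Fin (n + 1))) :
    ∑ j : Fin (n + 1), gainedAt e j =
      4 - zeroInd (valueAt e 0) - zeroInd (valueAt e n) - zeroInd (valueAt e 0 - n) := by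
  rw [Fin.sum_univ_eq_sum_range (fun j => gainedAt e j)]
  simp only [gainedAt]
  rw [Finset.sum_add_distrib,
    sum_ite_lt_add_ite_pos n (fun j => zeroInd (valueAt e (j + 1)))
      (fun j => zeroInd (valueAt e j)), Finset.sum_add_distrib]
  have h1 := sum_comp_valueAt e zeroInd
  rw [sum_zeroInd_range] at h1
  have h2 := h1
  rw [Finset.sum_range_succ] at h1
  rw [Finset.sum_range_succ'] at h2
  have h3 : ∑ j ∈ Finset.range (n + 1),
      (if j = 0 then zeroInd (valueAt e 0) else adjInd (valueAt e 0) (valueAt e j)) =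
      zeroInd (valueAt e 0) + ∑ j ∈ Finset.range (n + 1), adjInd (valueAt e 0) (valueAt e j) := by
    rw [Finset.sum_range_succ', Finset.sum_range_succ']
    simp only [Nat.succ_ne_zero, if_false, if_true, adjInd]
    rw [if_neg (by omega)]
    ring
  have h4 := sum_adjInd_range n (a := (e 0 : ℕ)) (by omega)
  have h5 : valueAt e 0 = ((e 0 : ℕ) : ℤ) := valueAt_of_lt e (Nat.succ_pos n)
  rw [← sum_comp_valueAt e, ← h5] at h4
  rw [h3, h4]
  have h6 : (if (e 0 : ℕ) = 0 then (1 : ℤ) else 0) = zeroInd (valueAt e 0) := by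
    rw [h5]; simp only [zeroInd]; split_ifs <;> omega
  have h7 : (if (e 0 : ℕ) = n then (1 : ℤ) else 0) = zeroInd (valueAt e 0 - n) := by
    rw [h5]; simp only [zeroInd]; split_ifs <;> omega
  rw [h6, h7]
  linarith

theorem adjInd_mem (x y : ℤ) : 0 ≤ adjInd x y ∧ adjInd x y ≤ 1 := by
  simp only [adjInd]; split_ifs <;> simp

theorem zeroInd_mem (x : ℤ) : 0 ≤ zeroInd x ∧ zeroInd x ≤ 1 := by
  simp only [zeroInd]; split_ifs <;> simp

theorem lostAt_mem {n : ℕ} (e : Equiv.Perm (Fin (n + 1))) (j : ℕ) :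
    0 ≤ lostAt e j ∧ lostAt e j ≤ 2 := by
  have h1 := adjInd_mem (valueAt e j) (valueAt e (j + 1))
  have h2 := adjInd_mem (valueAt e (j - 1)) (valueAt e j)
  simp only [lostAt]; split_ifs <;> omega

theorem gainedAt_mem {n : ℕ} (e : Equiv.Perm (Fin (n + 1))) (j : ℕ) :
    0 ≤ gainedAt e j ∧ gainedAt e j ≤ 3 := by
  have h1 := zeroInd_mem (valueAt e (j + 1))
  have h2 := zeroInd_mem (valueAt e (j - 1))
  have h3 := zeroInd_mem (valueAt e 0)
  have h4 := adjInd_mem (valueAt e 0) (valueAt e j)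
  simp only [gainedAt]; split_ifs <;> omega

/-! ### Comparison with the generator of a birth and death chain -/

/-- The event that an insertion after `j` changes more than one adjacency. -/
def multipleChange {n : ℕ} (j : ℕ) : Set (Equiv.Perm (Fin (n + 1))) :=
  {e | 2 ≤ lostAt e j + gainedAt e j}

/-- A fixed point adds a cycle, hence a factor θ; insertion after j adds none. For fixed e, the
nonzero images of the new element are reindexed as e j. -/
theorem ewensExp_succ {θ : ℝ} (hθ : 0 < θ) {n : ℕ} (F : Equiv.Perm (Fin (n + 2)) → ℝ) :
    ewensExp θ F = (θ + (n + 1 : ℕ))⁻¹ *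
      ewensExp θ (fun e : Equiv.Perm (Fin (n + 1)) =>
        θ * F (insertFixed e) + ∑ j, F (insertAfter e j)) := by
  have hne : θ + ((n + 1 : ℕ) : ℝ) ≠ 0 := by positivity
  have hpos : (∏ k ∈ Finset.range (n + 1), (θ + (k : ℝ))) ≠ 0 :=
    (Finset.prod_pos fun k _ => by positivity).ne'
  simp only [ewensExp]
  rw [← Equiv.sum_comp Equiv.Perm.decomposeFin.symm, Fintype.sum_prod_type, Finset.sum_comm,
    Finset.mul_sum]
  refine Finset.sum_congr rfl fun e _ => ?_
  rw [Fin.sum_univ_succ, ← Equiv.sum_comp e]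
  simp only [ewensWeight, numCycles_decomposeFin_zero, numCycles_decomposeFin_succ]
  rw [← Finset.mul_sum, Finset.prod_range_succ]
  simp only [insertFixed, insertAfter]
  field_simp
  ring

/-- The generator of the birth and death chain that the number of adjacencies follows. -/
noncomputable def birthDeath (h : ℕ → ℝ) (a : ℕ) : ℝ :=
  -- The truncated a - 1 at a = 0 is harmless because of the factor a.
  2 * a * (h (a - 1) - h a) + 4 * (h (a + 1) - h a)

/-- Off `multipleChange` at most one adjacency is lost or gained, and the linear expression is
exact. On it, the crude bounds 2 for losses and 3 for gains give 1 + 2 + 3 = 6 increments of h, each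
at most C. -/
theorem abs_insertAfter_sub_le {n : ℕ} (e : Equiv.Perm (Fin (n + 1))) (j : Fin (n + 1))
    (h : ℕ → ℝ) {C : ℝ} (hh : ∀ a, 0 ≤ h a ∧ h a ≤ C) :
    |h (numAdjacencies (insertAfter e j)) - h (numAdjacencies e) -
      (lostAt e j * (h (numAdjacencies e - 1) - h (numAdjacencies e)) +
        gainedAt e j * (h (numAdjacencies e + 1) - h (numAdjacencies e)))| ≤
      6 * C * (multipleChange (j : ℕ)).indicator 1 e := by
  have key := numAdjacencies_insertAfter e j
  obtain ⟨l0, l2⟩ := lostAt_mem e j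
  obtain ⟨g0, g3⟩ := gainedAt_mem e j
  set A := numAdjacencies e
  set A' := numAdjacencies (insertAfter e j)
  set l := lostAt e j with hl
  set g := gainedAt e j with hg
  by_cases hm : e ∈ multipleChange (j : ℕ)
  · rw [Set.indicator_of_mem hm, Pi.one_apply, mul_one]
    have d : ∀ a b, |h a - h b| ≤ C := fun a b => by
      rw [abs_le]; constructor <;> linarith [(hh a).1, (hh a).2, (hh b).1, (hh b).2]
    have hl' : |(l : ℝ)| ≤ 2 := by
      rw [abs_of_nonneg (by exact_mod_cast l0)]; exact_mod_cast l2
    have hg' : |(g : ℝ)| ≤ 3 := by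
      rw [abs_of_nonneg (by exact_mod_cast g0)]; exact_mod_cast g3
    have hC : 0 ≤ C := (hh 0).1.trans (hh 0).2
    calc _ ≤ |h A' - h A| + (|(l : ℝ)| * |h (A - 1) - h A| + |(g : ℝ)| * |h (A + 1) - h A|) := by
          rw [← abs_mul, ← abs_mul]
          exact (abs_sub _ _).trans (add_le_add le_rfl (abs_add_le _ _))
      _ ≤ C + (2 * C + 3 * C) := by
          gcongr
          · exact d _ _
          · exact d _ _
          · exact d _ _
      _ = 6 * C := by ring
  · have hm' : ¬ 2 ≤ l + g := hm
    rw [Set.indicator_of_notMem hm, mul_zero]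
    have hcases : (l = 0 ∧ g = 0) ∨ (l = 1 ∧ g = 0) ∨ (l = 0 ∧ g = 1) := by omega
    rcases hcases with ⟨h1, h2⟩ | ⟨h1, h2⟩ | ⟨h1, h2⟩
    · have : A' = A := by omega
      simp [h1, h2, this]
    · have : A' = A - 1 := by omega
      simp [h1, h2, this]
    · have : A' = A + 1 := by omega
      simp [h1, h2, this]

/-- The number of boundary coincidences that reduce the total number of gained adjacencies. -/
noncomputable def boundaryCount {n : ℕ} (e : Equiv.Perm (Fin (n + 1))) : ℝ :=
  zeroInd (valueAt e 0) + zeroInd (valueAt e n) + zeroInd (valueAt e 0 - n)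

theorem abs_sum_insertAfter_sub_le {n : ℕ} (e : Equiv.Perm (Fin (n + 1)))
    (h : ℕ → ℝ) {C : ℝ} (hh : ∀ a, 0 ≤ h a ∧ h a ≤ C) :
    |∑ j, (h (numAdjacencies (insertAfter e j)) - h (numAdjacencies e)) -
      birthDeath h (numAdjacencies e)| ≤
      C * boundaryCount e + 6 * C * ∑ j : Fin (n + 1), (multipleChange (j : ℕ)).indicator 1 e := by
  set A := numAdjacencies e with hA
  have hl : (∑ j : Fin (n + 1), (lostAt e j : ℝ)) = 2 * A := by
    exact_mod_cast congrArg (Int.cast : ℤ → ℝ) (sum_lostAt e)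
  have hg : (∑ j : Fin (n + 1), (gainedAt e j : ℝ)) = 4 - boundaryCount e := by
    have := congrArg (Int.cast : ℤ → ℝ) (sum_gainedAt e)
    push_cast at this
    rw [this, boundaryCount]; ring
  have hsplit : ∑ j, (h (numAdjacencies (insertAfter e j)) - h A) - birthDeath h A =
      ∑ j : Fin (n + 1), (h (numAdjacencies (insertAfter e j)) - h A -
        (lostAt e j * (h (A - 1) - h A) + gainedAt e j * (h (A + 1) - h A))) -
      boundaryCount e * (h (A + 1) - h A) := by
    rw [Finset.sum_sub_distrib (fun j => h (numAdjacencies (insertAfter e j)) - h A),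
      Finset.sum_add_distrib, ← Finset.sum_mul, ← Finset.sum_mul,
      hl, hg, birthDeath]
    ring
  have hb : 0 ≤ boundaryCount e := by
    have h1 := (zeroInd_mem (valueAt e 0)).1
    have h2 := (zeroInd_mem (valueAt e n)).1
    have h3 := (zeroInd_mem (valueAt e 0 - n)).1
    rw [boundaryCount]; exact_mod_cast add_nonneg (add_nonneg h1 h2) h3
  rw [hsplit]
  refine (abs_sub _ _).trans ?_
  rw [add_comm]
  refine add_le_add ?_ ?_
  · rw [abs_mul, abs_of_nonneg hb, mul_comm]
    refine mul_le_mul_of_nonneg_right ?_ hb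
    rw [abs_le]; constructor <;> linarith [(hh A).1, (hh A).2, (hh (A + 1)).1, (hh (A + 1)).2]
  · rw [Finset.mul_sum]
    exact (Finset.abs_sum_le_sum_abs _ _).trans
      (Finset.sum_le_sum fun j _ => abs_insertAfter_sub_le e j h hh)


/-! ### Multiple changes and boundary coincidences are rare -/

/-- The event that the value at `x` is zero or a neighbour of the value at `j`. -/
def nearEvent {N : ℕ} (x j : ℕ) : Set (Equiv.Perm (Fin N)) :=
  {e | 0 ≤ valueAt e x ∧
    (valueAt e x = 0 ∨ valueAt e x = valueAt e j + 1 ∨ valueAt e x = valueAt e j - 1)}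

/-- The constant in the probability bounds for a single constraint. -/
noncomputable def constraintConst (θ : ℝ) : ℝ := 9 * swapFactor θ

theorem constraintConst_pos {θ : ℝ} (hθ : 0 < θ) : 0 < constraintConst θ :=
  mul_pos (by norm_num) (swapFactor_pos hθ)

theorem card_filter_near_le {N : ℕ} (v : Fin N) :
    (Finset.univ.filter fun w : Fin N =>
      (w : ℕ) = 0 ∨ (w : ℕ) = v + 1 ∨ (w : ℕ) + 1 = v).card ≤ 3 := by
  refine (Finset.card_le_card_of_injOn (t := {0, (v : ℕ) + 1, (v : ℕ) - 1}) Fin.val ?_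
    Fin.val_injective.injOn).trans Finset.card_le_three
  intro w hw
  simp only [Finset.coe_filter, Finset.mem_univ, true_and, Set.mem_ofPred_eq] at hw
  simp only [Finset.coe_insert, Finset.coe_singleton, Set.mem_insert_iff, Set.mem_singleton_iff]
  omega

theorem ewensProb_inter_nearEvent_le {θ : ℝ} (hθ : 0 < θ) {N : ℕ} (hN : 3 ≤ N)
    (X : Finset (Fin N)) (hXc : X.card ≤ 2) (x : ℕ) (hx : ∀ i ∈ X, (i : ℕ) ≠ x)
    (j : Fin N) (hj : j ∈ X) (B : Set (Equiv.Perm (Fin N)))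
    (hB : ∀ e e' : Equiv.Perm (Fin N), (∀ i ∈ X, e i = e' i) → e ∈ B → e' ∈ B) :
    ewensProb θ (B ∩ nearEvent x j) ≤ constraintConst θ / N * ewensProb θ B := by
  have hN' : (0 : ℝ) < N := by exact_mod_cast (by omega : 0 < N)
  by_cases hxN : x < N
  · have h := ewensProb_value_mem_le_div hθ hN X hXc ⟨x, hxN⟩ (fun h => hx _ h rfl) B
      (fun e => Finset.univ.filter fun w : Fin N =>
        (w : ℕ) = 0 ∨ (w : ℕ) = (e j : ℕ) + 1 ∨ (w : ℕ) + 1 = (e j : ℕ)) 3 hB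
      (fun e e' h => by rw [h j hj]) (fun e => card_filter_near_le (e j))
    refine le_trans (ewensProb_mono hθ ?_) (h.trans (le_of_eq ?_))
    · rintro e ⟨he, h1, h2⟩
      refine ⟨he, ?_⟩
      rw [valueAt_of_lt e hxN, valueAt_fin] at h2
      simp only [Finset.mem_filter, Finset.mem_univ, true_and]
      omega
    · rw [constraintConst]; push_cast; ring
  -- Off the range the value is -5, which the clause `0 ≤ valueAt e x` rules out.
  · have : B ∩ nearEvent x j = ∅ := by
      ext e
      simp only [Set.mem_inter_iff, nearEvent, Set.mem_ofPred_eq, Set.mem_empty_iff_false, iff_false]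
      rintro ⟨_, h, _⟩
      rw [valueAt_of_le e (by omega)] at h
      omega
    rw [this, ewensProb_empty]
    exact mul_nonneg (div_nonneg (constraintConst_pos hθ).le hN'.le) (ewensProb_nonneg hθ B)

theorem ewensProb_nearEvent_le {θ : ℝ} (hθ : 0 < θ) {N : ℕ} (hN : 3 ≤ N)
    (x : ℕ) (j : Fin N) (hxj : (j : ℕ) ≠ x) :
    ewensProb θ (nearEvent (N := N) x j) ≤ constraintConst θ / N := by
  have := ewensProb_inter_nearEvent_le hθ hN {j} (by simp) x (by simpa using hxj) j (by simp)
    Set.univ (fun _ _ _ h => h)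
  rwa [Set.univ_inter, ewensProb_univ hθ, mul_one] at this

theorem ewensProb_valueAt_eq_le {θ : ℝ} (hθ : 0 < θ) {N : ℕ} (hN : 3 ≤ N) (x c : ℕ) :
    ewensProb θ {e : Equiv.Perm (Fin N) | valueAt e x = c} ≤ constraintConst θ / N := by
  have hN' : (0 : ℝ) < N := by exact_mod_cast (by omega : 0 < N)
  by_cases hxN : x < N
  · have h := ewensProb_value_mem_le_div hθ hN ∅ (by simp) ⟨x, hxN⟩ (by simp) Set.univ
      (fun _ => Finset.univ.filter fun w : Fin N => (w : ℕ) = c) 3 (fun _ _ _ h => h)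
      (fun _ _ _ => rfl) (fun e => by
        refine (Finset.card_le_card_of_injOn (t := {c}) Fin.val ?_
          Fin.val_injective.injOn).trans (by simp)
        intro w hw
        simpa using hw)
    refine le_trans (ewensProb_mono hθ ?_) (h.trans (le_of_eq ?_))
    · intro e he
      rw [Set.mem_ofPred_eq, valueAt_of_lt e hxN] at he
      refine ⟨trivial, ?_⟩
      simp only [Finset.mem_filter, Finset.mem_univ, true_and]
      omega
    · rw [constraintConst, ewensProb_univ hθ]; push_cast; ring
  · have : {e : Equiv.Perm (Fin N) | valueAt e x = c} = ∅ := by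
      ext e
      simp only [Set.mem_ofPred_eq, Set.mem_empty_iff_false, iff_false]
      rw [valueAt_of_le e (by omega)]
      omega
    rw [this, ewensProb_empty]
    exact div_nonneg (constraintConst_pos hθ).le hN'.le

theorem ewensProb_nearEvent_inter_le {θ : ℝ} (hθ : 0 < θ) {N : ℕ} (hN : 3 ≤ N)
    (x y : ℕ) (j : Fin N) (hxj : (j : ℕ) ≠ x) (hyj : (j : ℕ) ≠ y) (hxy : x ≠ y) :
    ewensProb θ (nearEvent (N := N) x j ∩ nearEvent y j) ≤ (constraintConst θ / N) ^ 2 := by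
  have hN' : (0 : ℝ) < N := by exact_mod_cast (by omega : 0 < N)
  by_cases hxN : x < N
  · refine (ewensProb_inter_nearEvent_le hθ hN {j, ⟨x, hxN⟩} Finset.card_le_two y ?_ j (by simp)
      (nearEvent x j) ?_).trans ?_
    · intro i hi
      rw [Finset.mem_insert, Finset.mem_singleton] at hi
      rcases hi with rfl | rfl
      · exact hyj
      · exact hxy
    · intro e e' h he
      have h1 := h j (by simp)
      have h2 := h ⟨x, hxN⟩ (by simp)
      simp only [nearEvent, Set.mem_ofPred_eq, valueAt_of_lt _ hxN, valueAt_fin, h1, h2] at he ⊢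
      exact he
    · rw [sq]
      exact mul_le_mul_of_nonneg_left (ewensProb_nearEvent_le hθ hN x j hxj)
        (div_nonneg (constraintConst_pos hθ).le hN'.le)
  · have : nearEvent (N := N) x j ∩ nearEvent y j ⊆ ∅ := by
      rintro e ⟨⟨h, _⟩, _⟩
      rw [valueAt_of_le e (by omega)] at h
      omega
    refine (ewensProb_mono hθ this).trans ?_
    rw [ewensProb_empty]
    positivity

theorem ewensProb_value_one_inter_nearEvent_le {θ : ℝ} (hθ : 0 < θ) {N : ℕ} (hN : 3 ≤ N)
    (x : ℕ) (j : Fin N) (hxj : (j : ℕ) ≠ x) :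
    ewensProb θ ({e : Equiv.Perm (Fin N) | valueAt e j = (1 : ℕ)} ∩ nearEvent x j) ≤
      (constraintConst θ / N) ^ 2 := by
  have hN' : (0 : ℝ) < N := by exact_mod_cast (by omega : 0 < N)
  refine (ewensProb_inter_nearEvent_le hθ hN {j} (by simp) x (by simpa using hxj) j (by simp)
    _ ?_).trans ?_
  · intro e e' h he
    have h1 := h j (by simp)
    simp only [Set.mem_ofPred_eq, valueAt_fin, h1] at he ⊢
    exact he
  · rw [sq]
    exact mul_le_mul_of_nonneg_left (ewensProb_valueAt_eq_le hθ hN j 1)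
      (div_nonneg (constraintConst_pos hθ).le hN'.le)

/-- Two changes involve either two of the positions j - 1, j + 1, 0, or a single neighbour of j that
is both lost and gained. In the latter case the neighbour has value 0 and j has value 1. For j ≥ 2
the positions are distinct, so each event imposes two constraints and costs O(1/N²). -/
theorem multipleChange_subset {n j : ℕ} (h2 : 2 ≤ j) (hj : j ≤ n) :
    (multipleChange j : Set (Equiv.Perm (Fin (n + 1)))) ⊆
      (nearEvent (j - 1) j ∩ nearEvent (j + 1) j) ∪ (nearEvent (j - 1) j ∩ nearEvent 0 j) ∪
      (nearEvent (j + 1) j ∩ nearEvent 0 j) ∪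
      ({e | valueAt e j = (1 : ℕ)} ∩ nearEvent (j - 1) j) ∪
      ({e | valueAt e j = (1 : ℕ)} ∩ nearEvent (j + 1) j) := by
  intro e he
  have he' : 2 ≤ lostAt e j + gainedAt e j := he
  have v0 := valueAt_nonneg e (i := 0) (by omega)
  have v1 := valueAt_nonneg e (i := j - 1) (by omega)
  have v2 := valueAt_nonneg e (i := j) (by omega)
  simp only [nearEvent, Set.mem_union, Set.mem_inter_iff, Set.mem_ofPred_eq]
  simp only [lostAt, gainedAt, if_pos (show 0 < j by omega), if_neg (show j ≠ 0 by omega)] at he'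
  by_cases hjn : j < n
  · have v3 := valueAt_nonneg e (i := j + 1) (by omega)
    simp only [hjn, if_true, adjInd, zeroInd] at he'
    generalize valueAt e j = a at *
    generalize valueAt e (j - 1) = b at *
    generalize valueAt e (j + 1) = c at *
    generalize valueAt e 0 = d at *
    clear he
    by_contra hcon
    split_ifs at he' <;> omega
  · simp only [hjn, if_false, adjInd, zeroInd] at he'
    generalize valueAt e j = a at *
    generalize valueAt e (j - 1) = b at *
    generalize valueAt e (j + 1) = c at *
    generalize valueAt e 0 = d at *
    clear he
    by_contra hcon
    split_ifs at he' <;> omega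

theorem ewensProb_multipleChange_le {θ : ℝ} (hθ : 0 < θ) {n : ℕ} (hn : 2 ≤ n)
    (j : Fin (n + 1)) (h2 : 2 ≤ (j : ℕ)) :
    ewensProb θ (multipleChange j : Set (Equiv.Perm (Fin (n + 1)))) ≤
      5 * (constraintConst θ / (n + 1 : ℕ)) ^ 2 := by
  have hN : 3 ≤ n + 1 := by omega
  refine (ewensProb_mono hθ (multipleChange_subset h2 (by omega))).trans ?_
  have a5 := ewensProb_value_one_inter_nearEvent_le hθ hN (j + 1) j (by omega)
  have a4 := ewensProb_value_one_inter_nearEvent_le hθ hN (j - 1) j (by omega)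
  have a3 := ewensProb_nearEvent_inter_le hθ hN (j + 1) 0 j (by omega) (by omega) (by omega)
  have a2 := ewensProb_nearEvent_inter_le hθ hN (j - 1) 0 j (by omega) (by omega) (by omega)
  have a1 := ewensProb_nearEvent_inter_le hθ hN (j - 1) (j + 1) j (by omega) (by omega) (by omega)
  refine (ewensProb_union_le_add hθ (ewensProb_union_le_add hθ (ewensProb_union_le_add hθ
    (ewensProb_union_le_add hθ a1 a2) a3) a4) a5).trans (le_of_eq ?_)
  ring

/-- For j = 0 or 1 positions coincide and a single constraint may change two adjacencies. The bound
O(1/N) suffices, as there are only two such j. -/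
theorem ewensProb_multipleChange_le_of_lt {θ : ℝ} (hθ : 0 < θ) {n : ℕ} (hn : 2 ≤ n)
    (j : Fin (n + 1)) (h2 : (j : ℕ) < 2) :
    ewensProb θ (multipleChange j : Set (Equiv.Perm (Fin (n + 1)))) ≤
      3 * (constraintConst θ / (n + 1 : ℕ)) := by
  have hN : 3 ≤ n + 1 := by omega
  have hsub : (multipleChange (j : ℕ) : Set (Equiv.Perm (Fin (n + 1)))) ⊆
      nearEvent (j + 1) j ∪ {e | valueAt e 0 = (0 : ℕ)} ∪ nearEvent (1 - (j : ℕ)) j := by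
    intro e he
    have he' : 2 ≤ lostAt e j + gainedAt e j := he
    have v0 := valueAt_nonneg e (i := 0) (by omega)
    have v1 := valueAt_nonneg e (i := 1) (by omega)
    have v2 := valueAt_nonneg e (i := 2) (by omega)
    simp only [nearEvent, Set.mem_union, Set.mem_ofPred_eq]
    have hcases : (j : ℕ) = 0 ∨ (j : ℕ) = 1 := by omega
    rcases hcases with h | h
    · simp only [h, lostAt, gainedAt, if_pos (show 0 < n by omega), lt_irrefl, if_false, if_true,
        adjInd, zeroInd, zero_add, Nat.sub_zero] at he' ⊢
      by_contra hcon
      split_ifs at he' <;> omega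
    · simp only [h, lostAt, gainedAt, if_pos (show 1 < n by omega), one_ne_zero, if_false,
        if_pos (show 0 < 1 by omega),
        adjInd, zeroInd, Nat.sub_self, Nat.reduceAdd] at he' ⊢
      by_contra hcon
      split_ifs at he' <;> omega
  refine (ewensProb_mono hθ hsub).trans ?_
  have a1 := ewensProb_nearEvent_le hθ hN (j + 1) j (by omega)
  have a2 := ewensProb_valueAt_eq_le hθ hN 0 0
  have a3 := ewensProb_nearEvent_le hθ hN (1 - (j : ℕ)) j (by omega)
  refine (ewensProb_union_le_add hθ (ewensProb_union_le_add hθ a1 a2) a3).trans (le_of_eq ?_)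
  ring

theorem sum_ewensProb_multipleChange_le {θ : ℝ} (hθ : 0 < θ) {n : ℕ} (hn : 2 ≤ n) :
    ∑ j : Fin (n + 1), ewensProb θ (multipleChange j : Set (Equiv.Perm (Fin (n + 1)))) ≤
      (6 * constraintConst θ + 5 * constraintConst θ ^ 2) / (n + 1 : ℕ) := by
  have hN' : (0 : ℝ) < (n + 1 : ℕ) := by positivity
  have hc := constraintConst_pos hθ
  set c := constraintConst θ / (n + 1 : ℕ) with hcdef
  have hc0 : 0 ≤ c := div_nonneg hc.le hN'.le
  have hle : ∀ j : Fin (n + 1),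
      ewensProb θ (multipleChange j : Set (Equiv.Perm (Fin (n + 1)))) ≤
        (if (j : ℕ) < 2 then 3 * c else 0) + 5 * c ^ 2 := by
    intro j
    split_ifs with h
    · exact (ewensProb_multipleChange_le_of_lt hθ hn j h).trans
        (le_add_of_nonneg_right (by positivity))
    · rw [zero_add]
      exact ewensProb_multipleChange_le hθ hn j (by omega)
  refine (Finset.sum_le_sum fun j _ => hle j).trans (le_of_eq ?_)
  rw [Finset.sum_add_distrib, Fin.sum_univ_eq_sum_range (fun j => if j < 2 then 3 * c else 0),
    ← Finset.sum_filter]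
  have : (Finset.range (n + 1)).filter (· < 2) = Finset.range 2 := by
    ext i; simp; omega
  rw [this]
  simp only [Finset.sum_const, Finset.card_range, Finset.card_univ, Fintype.card_fin,
    nsmul_eq_mul, hcdef]
  field_simp
  push_cast
  ring

theorem ewensExp_zeroInd_eq (θ : ℝ) {N : ℕ} (x c : ℕ) :
    ewensExp θ (fun e : Equiv.Perm (Fin N) => (zeroInd (valueAt e x - c) : ℝ)) =
      ewensProb θ {e : Equiv.Perm (Fin N) | valueAt e x = c} := by
  rw [ewensProb]
  congr 1
  ext e
  by_cases h : valueAt e x = c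
  · simp [zeroInd, h]
  · simp [zeroInd, h, sub_eq_zero]

theorem ewensExp_boundaryCount_le {θ : ℝ} (hθ : 0 < θ) {n : ℕ} (hn : 2 ≤ n) :
    ewensExp θ (boundaryCount : Equiv.Perm (Fin (n + 1)) → ℝ) ≤
      3 * (constraintConst θ / (n + 1 : ℕ)) := by
  have hN : 3 ≤ n + 1 := by omega
  have h : (boundaryCount : Equiv.Perm (Fin (n + 1)) → ℝ) = fun e =>
      (zeroInd (valueAt e 0 - (0 : ℕ)) : ℝ) + zeroInd (valueAt e n - (0 : ℕ)) +
        zeroInd (valueAt e 0 - n) := by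
    ext e; simp [boundaryCount]
  rw [h, ewensExp_add, ewensExp_add, ewensExp_zeroInd_eq, ewensExp_zeroInd_eq, ewensExp_zeroInd_eq]
  have a1 := ewensProb_valueAt_eq_le hθ hN 0 0
  have a2 := ewensProb_valueAt_eq_le hθ hN n 0
  have a3 := ewensProb_valueAt_eq_le hθ hN 0 n
  linarith

/-! ### The one-step error -/

/-- The constant in the one-step comparison with the birth and death chain. -/
noncomputable def stepConst (θ C : ℝ) : ℝ :=
  C * (θ * constraintConst θ + 3 * constraintConst θ +
    6 * (6 * constraintConst θ + 5 * constraintConst θ ^ 2))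

/-- Three errors of order 1/N, each multiplied by the insertion probability: a fixed-point insertion
changes the count only when the leading value is 0, the boundary count corrects the birth rate, and
multiple changes spoil linearity. -/
theorem abs_ewensExp_numAdjacencies_succ_sub_le {θ : ℝ} (hθ : 0 < θ) {n : ℕ} (hn : 2 ≤ n)
    (h : ℕ → ℝ) {C : ℝ} (hh : ∀ a, 0 ≤ h a ∧ h a ≤ C) :
    |ewensExp θ (fun e : Equiv.Perm (Fin (n + 2)) => h (numAdjacencies e)) -
      ewensExp θ (fun e : Equiv.Perm (Fin (n + 1)) =>
        h (numAdjacencies e) + (θ + (n + 1 : ℕ))⁻¹ * birthDeath h (numAdjacencies e))| ≤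
      (θ + (n + 1 : ℕ))⁻¹ * (stepConst θ C / (n + 1 : ℕ)) := by
  have hN : 3 ≤ n + 1 := by omega
  have hpos : 0 < θ + ((n + 1 : ℕ) : ℝ) := by positivity
  have hC : 0 ≤ C := (hh 0).1.trans (hh 0).2
  have heq : ewensExp θ (fun e : Equiv.Perm (Fin (n + 2)) => h (numAdjacencies e)) -
      ewensExp θ (fun e : Equiv.Perm (Fin (n + 1)) =>
        h (numAdjacencies e) + (θ + (n + 1 : ℕ))⁻¹ * birthDeath h (numAdjacencies e)) =
      (θ + (n + 1 : ℕ))⁻¹ * ewensExp θ (fun e : Equiv.Perm (Fin (n + 1)) =>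
        θ * (h (numAdjacencies (insertFixed e)) - h (numAdjacencies e)) +
        (∑ j, (h (numAdjacencies (insertAfter e j)) - h (numAdjacencies e)) -
          birthDeath h (numAdjacencies e))) := by
    rw [ewensExp_succ hθ, ← ewensExp_const_mul, ← ewensExp_const_mul, ← ewensExp_sub]
    congr 1
    ext e
    rw [Finset.sum_sub_distrib, Finset.sum_const, Finset.card_univ, Fintype.card_fin, nsmul_eq_mul]
    field_simp
    ring
  rw [heq, abs_mul, abs_of_pos (inv_pos.2 hpos)]
  refine mul_le_mul_of_nonneg_left ?_ (inv_pos.2 hpos).le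
  have hpt : ∀ e : Equiv.Perm (Fin (n + 1)),
      |θ * (h (numAdjacencies (insertFixed e)) - h (numAdjacencies e)) +
        (∑ j, (h (numAdjacencies (insertAfter e j)) - h (numAdjacencies e)) -
          birthDeath h (numAdjacencies e))| ≤
      θ * C * (zeroInd (valueAt e 0 - (0 : ℕ)) : ℝ) + (C * boundaryCount e +
        6 * C * ∑ j : Fin (n + 1), (multipleChange (j : ℕ)).indicator 1 e) := by
    intro e
    refine (abs_add_le _ _).trans (add_le_add ?_ (abs_sum_insertAfter_sub_le e h hh))
    have hf := numAdjacencies_insertFixed e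
    rw [abs_mul, abs_of_pos hθ, mul_assoc]
    refine mul_le_mul_of_nonneg_left ?_ hθ.le
    by_cases h0 : valueAt e 0 = 0
    · simp only [h0, zeroInd, Nat.cast_zero, sub_zero, if_true, Int.cast_one, mul_one]
      set a := numAdjacencies (insertFixed e)
      set b := numAdjacencies e
      rw [abs_le]; constructor <;> linarith [(hh a).1, (hh a).2, (hh b).1, (hh b).2]
    · have : numAdjacencies (insertFixed e) = numAdjacencies e := by
        simp only [zeroInd, h0, if_false] at hf
        omega
      simp [this, zeroInd, h0]
  refine (abs_ewensExp_le hθ hpt).trans ?_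
  rw [ewensExp_add, ewensExp_add, ewensExp_const_mul, ewensExp_const_mul, ewensExp_const_mul,
    ewensExp_sum, ewensExp_zeroInd_eq]
  have a1 := mul_le_mul_of_nonneg_left (ewensProb_valueAt_eq_le hθ hN 0 0) (mul_nonneg hθ.le hC)
  have a2 := mul_le_mul_of_nonneg_left (ewensExp_boundaryCount_le hθ hn) hC
  have a3 := mul_le_mul_of_nonneg_left (sum_ewensProb_multipleChange_le hθ hn)
    (mul_nonneg (by norm_num : (0 : ℝ) ≤ 6) hC)
  refine (add_le_add a1 (add_le_add a2 a3)).trans (le_of_eq ?_)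
  rw [stepConst]
  ring


/-! ### Test functions adapted to the generator -/

/-- The test functions `a ↦ e ^ (2 u) (1 - u) ^ a`, on which the birth and death generator acts
as `-2 u ∂/∂u`. -/
noncomputable def testFun (u : ℝ) (a : ℕ) : ℝ := Real.exp (2 * u) * (1 - u) ^ a

/-- The derivative of `testFun` in its real variable. -/
noncomputable def testFunDeriv (u : ℝ) (a : ℕ) : ℝ := 2 * testFun u a - a * testFun u (a - 1)

/-- The second derivative of `testFun` in its real variable. -/
noncomputable def testFunDeriv2 (u : ℝ) (a : ℕ) : ℝ :=
  2 * testFunDeriv u a - a * testFunDeriv u (a - 1)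

theorem testFun_mem {u : ℝ} (h0 : 0 ≤ u) (h1 : u ≤ 1) (a : ℕ) :
    0 ≤ testFun u a ∧ testFun u a ≤ Real.exp 2 := by
  have hp0 : 0 ≤ (1 - u) ^ a := pow_nonneg (by linarith) a
  have hp1 : (1 - u) ^ a ≤ 1 := pow_le_one₀ (by linarith) (by linarith)
  refine ⟨mul_nonneg (Real.exp_pos _).le hp0, ?_⟩
  calc testFun u a ≤ Real.exp 2 * 1 :=
        mul_le_mul (Real.exp_le_exp.2 (by linarith)) hp1 hp0 (Real.exp_pos _).le
    _ = Real.exp 2 := mul_one _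

theorem hasDerivAt_testFun (u : ℝ) (a : ℕ) :
    HasDerivAt (fun v => testFun v a) (testFunDeriv u a) u := by
  have h1 : HasDerivAt (fun v : ℝ => Real.exp (2 * v)) (Real.exp (2 * u) * 2) u := by
    simpa using ((hasDerivAt_id u).const_mul 2).exp
  have h2 : HasDerivAt (fun v : ℝ => (1 - v) ^ a) (a * (1 - u) ^ (a - 1) * (-1)) u := by
    exact ((hasDerivAt_id u).const_sub 1).pow a
  convert! h1.mul h2 using 1
  simp only [testFunDeriv, testFun]
  ring

theorem hasDerivAt_testFunDeriv (u : ℝ) (a : ℕ) :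
    HasDerivAt (fun v => testFunDeriv v a) (testFunDeriv2 u a) u :=
  ((hasDerivAt_testFun u a).const_mul 2).sub ((hasDerivAt_testFun u (a - 1)).const_mul (a : ℝ))

/-- A birth multiplies the function by 1 - u, so births give -4u f(a) and deaths give 2u a f(a - 1).
-/
theorem birthDeath_testFun (u : ℝ) (a : ℕ) :
    birthDeath (testFun u) a = -(2 * u) * testFunDeriv u a := by
  rcases a with _ | a
  · simp [birthDeath, testFunDeriv, testFun]; ring
  · simp only [birthDeath, testFunDeriv, testFun, Nat.add_sub_cancel]
    ring

theorem choose_mul_pow_mul_pow_le_one {v : ℝ} (h0 : 0 ≤ v) (h1 : v ≤ 1) (a k : ℕ) :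
    (a.choose k : ℝ) * (v ^ k * (1 - v) ^ (a - k)) ≤ 1 := by
  rcases Nat.lt_or_ge a k with h | h
  · simp [Nat.choose_eq_zero_of_lt h]
  have hv : 0 ≤ 1 - v := by linarith
  have key := add_pow v (1 - v) a
  rw [add_sub_cancel, one_pow] at key
  have := Finset.single_le_sum (s := Finset.range (a + 1))
    (f := fun m => v ^ m * (1 - v) ^ (a - m) * (a.choose m : ℝ)) (fun i _ => by positivity)
    (Finset.mem_range.2 (Nat.lt_succ_of_le h))
  rw [← key] at this
  calc _ = v ^ k * (1 - v) ^ (a - k) * (a.choose k : ℝ) := by ring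
    _ ≤ 1 := this

/-- The second derivative is not bounded uniformly in a, but the factor v² turns its terms into
multiples of binomial probabilities of 0, 1 and 2 successes. Their coefficients 4, 4, 2 add up to
10. -/
theorem sq_mul_abs_testFunDeriv2_le {v : ℝ} (h0 : 0 ≤ v) (h1 : v ≤ 1) (a : ℕ) :
    v ^ 2 * |testFunDeriv2 v a| ≤ 10 * Real.exp 2 := by
  have e1 := choose_mul_pow_mul_pow_le_one h0 h1 a 0
  have e2 := choose_mul_pow_mul_pow_le_one h0 h1 a 1
  have e3 := choose_mul_pow_mul_pow_le_one h0 h1 a 2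
  have hv : 0 ≤ 1 - v := by linarith
  have p1 : 0 ≤ (1 - v) ^ a := pow_nonneg hv _
  have p2 : 0 ≤ (1 - v) ^ (a - 1) := pow_nonneg hv _
  have hsub : a - 1 - 1 = a - 2 := by omega
  have hcast : (a : ℝ) * ((a - 1 : ℕ) : ℝ) = 2 * (a.choose 2 : ℝ) := by
    rw [Nat.cast_choose_two]
    rcases a with _ | a
    · simp
    · simp; ring
  have hexp : Real.exp (2 * v) ≤ Real.exp 2 := Real.exp_le_exp.2 (by linarith)
  simp only [Nat.choose_zero_right, Nat.cast_one, pow_zero, one_mul, Nat.sub_zero,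
    Nat.choose_one_right, pow_one] at e1 e2
  have hv2 : v ^ 2 ≤ 1 := pow_le_one₀ h0 h1
  have hq : v ^ 2 * |testFunDeriv2 v a| = Real.exp (2 * v) *
      |4 * (v ^ 2 * (1 - v) ^ a) - 4 * (v * (a * (v * (1 - v) ^ (a - 1)))) +
        2 * (a.choose 2 * (v ^ 2 * (1 - v) ^ (a - 2)))| := by
    have hl : v ^ 2 * |testFunDeriv2 v a| = |v ^ 2 * testFunDeriv2 v a| := by
      rw [abs_mul, abs_of_nonneg (sq_nonneg v)]
    have hr : ∀ t, Real.exp (2 * v) * |t| = |Real.exp (2 * v) * t| := fun t => by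
      rw [abs_mul, abs_of_pos (Real.exp_pos (2 * v))]
    rw [hl, hr]
    congr 1
    simp only [testFunDeriv2, testFunDeriv, testFun, hsub]
    linear_combination (v ^ 2 * Real.exp (2 * v) * (1 - v) ^ (a - 2)) * hcast
  have t1 : 0 ≤ v ^ 2 * (1 - v) ^ a ∧ v ^ 2 * (1 - v) ^ a ≤ 1 :=
    ⟨by positivity, mul_le_one₀ hv2 p1 e1⟩
  have t2 : 0 ≤ v * (a * (v * (1 - v) ^ (a - 1))) ∧ v * (a * (v * (1 - v) ^ (a - 1))) ≤ 1 :=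
    ⟨by positivity, mul_le_one₀ h1 (by positivity) e2⟩
  have t3 : 0 ≤ (a.choose 2 : ℝ) * (v ^ 2 * (1 - v) ^ (a - 2)) := by positivity
  rw [hq, mul_comm (10 : ℝ)]
  refine mul_le_mul hexp ?_ (abs_nonneg _) (Real.exp_pos _).le
  rw [abs_le]
  constructor <;> linarith [t1.1, t1.2, t2.1, t2.2]

/-- By `birthDeath_testFun` the left side is a first-order Taylor remainder in u, with displacement
2su; two uses of the mean value theorem express it by a second derivative at some y. -/
theorem abs_testFun_shrink_sub_le {u s : ℝ} (h0 : 0 ≤ u) (h1 : u ≤ 1) (hs0 : 0 < s)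
    (hs1 : s ≤ 1 / 4) (a : ℕ) :
    |testFun u a + s * birthDeath (testFun u) a - testFun (u * (1 - 2 * s)) a| ≤
      160 * Real.exp 2 * s ^ 2 := by
  rw [birthDeath_testFun]
  rcases h0.eq_or_lt with rfl | hu
  · simp; positivity
  set w := u * (1 - 2 * s) with hw
  have hwu : w < u := by rw [hw]; nlinarith
  have hwhalf : u / 2 ≤ w := by rw [hw]; nlinarith
  obtain ⟨x, ⟨hx1, hx2⟩, hx⟩ := exists_hasDerivAt_eq_slope (fun v => testFun v a)
    (fun v => testFunDeriv v a) hwu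
    (fun v _ => (hasDerivAt_testFun v a).continuousAt.continuousWithinAt)
    (fun v _ => hasDerivAt_testFun v a)
  obtain ⟨y, ⟨hy1, hy2⟩, hy⟩ := exists_hasDerivAt_eq_slope (fun v => testFunDeriv v a)
    (fun v => testFunDeriv2 v a) hx2
    (fun v _ => (hasDerivAt_testFunDeriv v a).continuousAt.continuousWithinAt)
    (fun v _ => hasDerivAt_testFunDeriv v a)
  rw [eq_div_iff (by linarith)] at hx hy
  have huw : u - w = 2 * s * u := by rw [hw]; ring
  have heq : testFun u a + s * (-(2 * u) * testFunDeriv u a) - testFun w a =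
      -((u - w) * ((u - x) * testFunDeriv2 y a)) := by
    linear_combination -hx + (u - w) * hy + testFunDeriv u a * huw
  have hb := sq_mul_abs_testFunDeriv2_le (v := y) (by linarith) (by linarith) a
  have habs := abs_nonneg (testFunDeriv2 y a)
  rw [heq, abs_neg, abs_mul, abs_mul, abs_of_pos (by linarith : 0 < u - w),
    abs_of_pos (by linarith : 0 < u - x)]
  calc (u - w) * ((u - x) * |testFunDeriv2 y a|)
      ≤ (u - w) * ((u - w) * |testFunDeriv2 y a|) := by
        gcongr
    _ = 4 * s ^ 2 * (u ^ 2 * |testFunDeriv2 y a|) := by rw [huw]; ring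
    -- Since s ≤ 1/4, the shrunk point w is at least u/2, so u ≤ 2y.
    _ ≤ 4 * s ^ 2 * ((2 * y) ^ 2 * |testFunDeriv2 y a|) := by
        gcongr
        linarith
    _ = 16 * s ^ 2 * (y ^ 2 * |testFunDeriv2 y a|) := by ring
    _ ≤ 16 * s ^ 2 * (10 * Real.exp 2) := by gcongr
    _ = 160 * Real.exp 2 * s ^ 2 := by ring

theorem abs_testFun_sub_one_le {u : ℝ} (h0 : 0 ≤ u) (h1 : u ≤ 1) (a : ℕ) :
    |testFun u a - 1| ≤ u * (2 * Real.exp 2 + a) := by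
  have hp1 : (1 - u) ^ a ≤ 1 := pow_le_one₀ (by linarith) (by linarith)
  have hp0 : 0 ≤ (1 - u) ^ a := pow_nonneg (by linarith) a
  have hB : 1 - a * u ≤ (1 - u) ^ a := by
    have := one_add_mul_le_pow (a := -u) (by linarith) a
    simpa [sub_eq_add_neg] using this
  have he1 : 1 ≤ Real.exp (2 * u) := Real.one_le_exp (by linarith)
  have he2 : Real.exp (2 * u) ≤ Real.exp 2 := Real.exp_le_exp.2 (by linarith)
  have he3 : Real.exp (2 * u) - 1 ≤ 2 * u * Real.exp (2 * u) := by
    have h := Real.add_one_le_exp (-(2 * u))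
    have h' : Real.exp (-(2 * u)) * Real.exp (2 * u) = 1 := by rw [← Real.exp_add]; simp
    nlinarith [Real.exp_pos (2 * u)]
  have hua : 0 ≤ u * a := by positivity
  have hue : u * Real.exp (2 * u) ≤ u * Real.exp 2 := mul_le_mul_of_nonneg_left he2 h0
  have hue0 : 0 ≤ u * Real.exp 2 := by positivity
  have hup : testFun u a ≤ Real.exp (2 * u) := mul_le_of_le_one_right (Real.exp_pos _).le hp1
  have hlo : (1 - u) ^ a ≤ testFun u a := le_mul_of_one_le_left hp0 he1
  rw [abs_le]
  constructor <;> linarith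

/-! ### Iterating the shrinking of the parameter -/

/-- The expectation of a test function of the number of adjacencies. -/
noncomputable def testExp (θ : ℝ) (n : ℕ) (u : ℝ) : ℝ :=
  ewensExp θ (fun e : Equiv.Perm (Fin (n + 1)) => testFun u (numAdjacencies e))

/-- The constant in the one-step comparison of `testExp`. -/
noncomputable def testStepConst (θ : ℝ) : ℝ := stepConst θ (Real.exp 2) + 160 * Real.exp 2

theorem testStepConst_nonneg {θ : ℝ} (hθ : 0 < θ) : 0 ≤ testStepConst θ := by
  have := constraintConst_pos hθ
  rw [testStepConst, stepConst]
  positivity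

theorem abs_testExp_succ_sub_le {θ : ℝ} (hθ : 0 < θ) {n : ℕ} (hn : 3 ≤ n) {u : ℝ}
    (h0 : 0 ≤ u) (h1 : u ≤ 1) :
    |testExp θ (n + 1) u - testExp θ n (u * (1 - 2 * (θ + (n + 1 : ℕ))⁻¹))| ≤
      testStepConst θ / (n + 1 : ℕ) ^ 2 := by
  have hN : (4 : ℝ) ≤ (n + 1 : ℕ) := by exact_mod_cast (by omega : 4 ≤ n + 1)
  set N : ℝ := ((n + 1 : ℕ) : ℝ) with hNdef
  have hN0 : 0 < N := by linarith
  set s := (θ + N)⁻¹ with hs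
  have hs0 : 0 < s := inv_pos.2 (by linarith)
  have hsN : s ≤ N⁻¹ := inv_anti₀ hN0 (by linarith)
  have hs4 : s ≤ 1 / 4 := hsN.trans (by rw [one_div]; exact inv_anti₀ (by norm_num) hN)
  have a1 := abs_ewensExp_numAdjacencies_succ_sub_le hθ (by omega : 2 ≤ n) (testFun u)
    (testFun_mem h0 h1)
  rw [← hNdef, ← hs] at a1
  have a2 : |ewensExp θ (fun e : Equiv.Perm (Fin (n + 1)) =>
        testFun u (numAdjacencies e) + s * birthDeath (testFun u) (numAdjacencies e)) -
      testExp θ n (u * (1 - 2 * s))| ≤ 160 * Real.exp 2 * s ^ 2 := by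
    rw [testExp, ← ewensExp_sub]
    refine (abs_ewensExp_le hθ fun e =>
      abs_testFun_shrink_sub_le h0 h1 hs0 hs4 (numAdjacencies e)).trans (le_of_eq ?_)
    exact ewensExp_const hθ _ _
  have hsc : 0 ≤ stepConst θ (Real.exp 2) := by
    have := constraintConst_pos hθ
    rw [stepConst]
    positivity
  refine (abs_sub_le _ _ _).trans ((add_le_add a1 a2).trans ?_)
  calc s * (stepConst θ (Real.exp 2) / N) + 160 * Real.exp 2 * s ^ 2
      ≤ N⁻¹ * (stepConst θ (Real.exp 2) / N) + 160 * Real.exp 2 * N⁻¹ ^ 2 := by gcongr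
    _ = testStepConst θ / N ^ 2 := by rw [testStepConst]; field_simp

theorem exists_abs_testExp_sub_one_le {θ : ℝ} (hθ : 0 < θ) (n : ℕ) :
    ∃ K, 0 ≤ K ∧ ∀ u, 0 ≤ u → u ≤ 1 → |testExp θ n u - 1| ≤ K * u := by
  refine ⟨ewensExp θ (fun e : Equiv.Perm (Fin (n + 1)) => 2 * Real.exp 2 + numAdjacencies e),
    Finset.sum_nonneg fun e _ => mul_nonneg (ewensWeight_nonneg hθ e) (by positivity),
    fun u h0 h1 => ?_⟩
  rw [testExp]
  nth_rewrite 1 [← ewensExp_const hθ (n + 1) 1]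
  rw [← ewensExp_sub, mul_comm, ← ewensExp_const_mul]
  exact abs_ewensExp_le hθ fun e => abs_testFun_sub_one_le h0 h1 _

/-- The step errors telescope through 1/(n + 1)² ≤ 1/n - 1/(n + 1), and the initial error is linear
in u, so it shrinks with u. -/
theorem abs_testExp_sub_one_le {θ : ℝ} (hθ : 0 < θ) {m : ℕ} (hm : 3 ≤ m) {K : ℝ} (hK0 : 0 ≤ K)
    (hK : ∀ u, 0 ≤ u → u ≤ 1 → |testExp θ m u - 1| ≤ K * u) {n : ℕ} (hn : m ≤ n) :
    ∀ u, 0 ≤ u → u ≤ 1 → |testExp θ n u - 1| ≤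
      K * ((θ + m) / (θ + n)) * u + testStepConst θ * ((m : ℝ)⁻¹ - (n : ℝ)⁻¹) := by
  have hm0 : (3 : ℝ) ≤ m := by exact_mod_cast hm
  induction n, hn using Nat.le_induction with
  | base =>
    intro u h0 h1
    rw [div_self (by positivity), sub_self, mul_zero, add_zero, mul_one]
    exact hK u h0 h1
  | succ n hmn ih =>
    intro u h0 h1
    have hn0 : (3 : ℝ) ≤ n := by exact_mod_cast hm.trans hmn
    have hD := testStepConst_nonneg hθ
    have a1 := abs_testExp_succ_sub_le hθ (hm.trans hmn) h0 h1
    set s := (θ + ((n + 1 : ℕ) : ℝ))⁻¹ with hs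
    have hpos : 0 < θ + ((n + 1 : ℕ) : ℝ) := by positivity
    have hs0 : 0 < s := inv_pos.2 hpos
    have hs4 : s ≤ 1 / 2 := by
      rw [hs, one_div]
      exact inv_anti₀ (by norm_num) (by push_cast; linarith)
    have a2 := ih (u * (1 - 2 * s)) (mul_nonneg h0 (by linarith))
      (mul_le_one₀ h1 (by linarith) (by linarith))
    -- Only 1 - 2s ≤ 1 - s = (θ + n)s is used: the weaker contraction telescopes exactly and still
    -- tends to 0.
    have b1 : (θ + m) / (θ + n) * (1 - 2 * s) ≤ (θ + m) / (θ + ((n + 1 : ℕ) : ℝ)) := by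
      have hn' : (0 : ℝ) < θ + n := by positivity
      have : 1 - 2 * s ≤ (θ + n) * s := by
        have : (θ + ((n + 1 : ℕ) : ℝ)) * s = 1 := mul_inv_cancel₀ hpos.ne'
        push_cast at this
        linarith
      calc (θ + m) / (θ + n) * (1 - 2 * s) ≤ (θ + m) / (θ + n) * ((θ + n) * s) := by gcongr
        _ = (θ + m) / (θ + ((n + 1 : ℕ) : ℝ)) := by rw [hs]; field_simp
    have b2 : testStepConst θ / ((n + 1 : ℕ) : ℝ) ^ 2 ≤
        testStepConst θ * ((n : ℝ)⁻¹ - ((n + 1 : ℕ) : ℝ)⁻¹) := by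
      rw [div_eq_mul_inv]
      refine mul_le_mul_of_nonneg_left ?_ hD
      have : (n : ℝ)⁻¹ - ((n + 1 : ℕ) : ℝ)⁻¹ = ((n : ℝ) * (n + 1))⁻¹ := by
        push_cast; field_simp; ring
      rw [this]
      push_cast
      refine inv_anti₀ (by positivity) ?_
      nlinarith
    have b3 : K * u * ((θ + m) / (θ + n) * (1 - 2 * s)) ≤
        K * u * ((θ + m) / (θ + ((n + 1 : ℕ) : ℝ))) :=
      mul_le_mul_of_nonneg_left b1 (mul_nonneg hK0 h0)
    refine (abs_sub_le _ _ _).trans ((add_le_add a1 a2).trans ?_)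
    linarith

theorem tendsto_testExp {θ : ℝ} (hθ : 0 < θ) {u : ℝ} (h0 : 0 ≤ u) (h1 : u ≤ 1) :
    Tendsto (fun n => testExp θ n u) atTop (nhds 1) := by
  rw [Metric.tendsto_atTop']
  intro ε hε
  have hD := testStepConst_nonneg hθ
  -- The start m is fixed first, to make the accumulated step error small; K depends on m, and n is
  -- taken large only afterwards.
  obtain ⟨m, hm⟩ := exists_nat_gt (max 3 (testStepConst θ / (ε / 2)))
  have hm3 : 3 < m := by exact_mod_cast (le_max_left _ _).trans_lt hm
  have hm0 : (0 : ℝ) < m := by exact_mod_cast (by omega : 0 < m)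
  have hmD : testStepConst θ * (m : ℝ)⁻¹ < ε / 2 := by
    have := (le_max_right _ _).trans_lt hm
    rw [div_lt_iff₀ (by linarith)] at this
    rw [← div_eq_mul_inv, div_lt_iff₀ hm0]
    linarith
  obtain ⟨K, hK0, hK⟩ := exists_abs_testExp_sub_one_le hθ m
  obtain ⟨M, hM⟩ := exists_nat_gt (K * (θ + m) / (ε / 2))
  refine ⟨max m M, fun n hn => ?_⟩
  have hnM : (M : ℝ) ≤ n := by exact_mod_cast ((le_max_right m M).trans hn.le)
  have hpos : 0 < θ + (n : ℝ) := by positivity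
  have key := abs_testExp_sub_one_le hθ hm3.le hK0 hK ((le_max_left m M).trans hn.le) u h0 h1
  have c1 : K * ((θ + m) / (θ + n)) < ε / 2 := by
    rw [← mul_div_assoc, div_lt_iff₀ hpos]
    rw [div_lt_iff₀ (by linarith)] at hM
    nlinarith
  have c0 : 0 ≤ K * ((θ + m) / (θ + n)) := by positivity
  have c2 : K * ((θ + m) / (θ + n)) * u ≤ K * ((θ + m) / (θ + n)) := mul_le_of_le_one_right c0 h1
  have c3 : testStepConst θ * ((m : ℝ)⁻¹ - (n : ℝ)⁻¹) ≤ testStepConst θ * (m : ℝ)⁻¹ :=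
    mul_le_mul_of_nonneg_left (sub_le_self _ (by positivity)) hD
  rw [Real.dist_eq]
  linarith

theorem tendsto_ewensExp_pow_numAdjacencies {θ : ℝ} (hθ : 0 < θ) {z : ℝ} (h0 : 0 ≤ z)
    (h1 : z ≤ 1) :
    Tendsto (fun N => ewensExp θ (fun e : Equiv.Perm (Fin N) => z ^ numAdjacencies e)) atTop
      (nhds (Real.exp (2 * (z - 1)))) := by
  rw [← tendsto_add_atTop_iff_nat 1]
  have h := (tendsto_testExp hθ (u := 1 - z) (by linarith) (by linarith)).const_mul
    (Real.exp (2 * (z - 1)))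
  rw [mul_one] at h
  refine h.congr fun n => ?_
  rw [testExp, ← ewensExp_const_mul]
  congr 1
  ext e
  rw [testFun, ← mul_assoc, ← Real.exp_add, sub_sub_cancel]
  ring_nf
  simp


/-! ### From generating functions to convergence in law -/

theorem integrable_pow_nat (ν : Measure ℕ) [IsProbabilityMeasure ν] {z : ℝ} (h0 : 0 ≤ z)
    (h1 : z ≤ 1) : Integrable (fun k : ℕ => z ^ k) ν :=
  Integrable.of_bound (C := 1) (by fun_prop)
    (ae_of_all _ fun k => by
      rw [Real.norm_of_nonneg (pow_nonneg h0 k)]; exact pow_le_one₀ h0 h1)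

theorem abs_integral_pow_sub_sum_le (ν : Measure ℕ) [IsProbabilityMeasure ν] {z : ℝ} (h0 : 0 ≤ z)
    (h1 : z ≤ 1) (m : ℕ) :
    |∫ k, z ^ k ∂ν - ∑ j ∈ Finset.range m, ν.real {j} * z ^ j| ≤ z ^ m := by
  have hint := integrable_pow_nat ν h0 h1
  have h2 := setIntegral_finset (μ := ν) (Finset.range m) (f := fun k : ℕ => z ^ k)
    hint.integrableOn
  have h3 := integral_add_compl (μ := ν) (s := (Finset.range m : Set ℕ))
    (Finset.measurableSet _) hint
  simp only [smul_eq_mul] at h2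
  rw [← h2, ← h3, add_sub_cancel_left]
  have := norm_setIntegral_le_of_norm_le_const (μ := ν) (s := (Finset.range m : Set ℕ)ᶜ)
    (f := fun k : ℕ => z ^ k) (C := z ^ m) (measure_lt_top _ _) (fun k hk => by
      rw [Real.norm_of_nonneg (pow_nonneg h0 k)]
      exact pow_le_pow_of_le_one h0 h1 (by simpa using hk))
  exact this.trans (mul_le_of_le_one_right (pow_nonneg h0 m) measureReal_le_one)

/-- Convergence of generating functions implies convergence of the point masses. -/
theorem tendsto_measureReal_singleton {ν : ℕ → Measure ℕ} [∀ n, IsProbabilityMeasure (ν n)]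
    {ρ : Measure ℕ} [IsProbabilityMeasure ρ]
    (h : ∀ z : ℝ, 0 ≤ z → z ≤ 1 →
      Tendsto (fun n => ∫ k, z ^ k ∂(ν n)) atTop (nhds (∫ k, z ^ k ∂ρ))) (m : ℕ) :
    Tendsto (fun n => (ν n).real {m}) atTop (nhds (ρ.real {m})) := by
  induction m using Nat.strong_induction_on with
  | _ m ih =>
    rw [Metric.tendsto_nhds]
    intro ε hε
    -- The mass at m is the coefficient of z^m. Lower terms converge by induction and the two tails
    -- contribute at most z^(m+1) each, so after division by z^m the error is below ε/4 + 2z ≤ 3ε/4.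
    set z := min (ε / 4) 1 with hz
    have hz0 : 0 < z := lt_min (by linarith) one_pos
    have hz1 : z ≤ 1 := min_le_right _ _
    have hzε : z ≤ ε / 4 := min_le_left _ _
    have hzm : 0 < z ^ m := pow_pos hz0 m
    have hlim := (h z hz0.le hz1).sub (tendsto_finsetSum (Finset.range m)
      fun j hj => (ih j (Finset.mem_range.1 hj)).mul_const (z ^ j))
    filter_upwards [Metric.tendsto_nhds.1 hlim (ε / 4 * z ^ m) (by positivity)] with n hn
    have t1 := abs_integral_pow_sub_sum_le (ν n) hz0.le hz1 (m + 1)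
    have t2 := abs_integral_pow_sub_sum_le ρ hz0.le hz1 (m + 1)
    rw [Finset.sum_range_succ, pow_succ] at t1 t2
    rw [Real.dist_eq] at hn ⊢
    have hzz : z ^ m * z ≤ z ^ m * (ε / 4) := mul_le_mul_of_nonneg_left hzε hzm.le
    refine lt_of_mul_lt_mul_right ?_ hzm.le
    rw [← abs_of_pos hzm, ← abs_mul, abs_of_pos hzm]
    rw [abs_le] at t1 t2
    rw [abs_lt] at hn ⊢
    have := mul_pos hε hzm
    constructor <;> nlinarith [t1.1, t1.2, t2.1, t2.2, hn.1, hn.2]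

/-- Fatou's lemma for the counting measure, applied to the point masses on S. -/
theorem measure_le_liminf_of_tendsto_singleton {ν : ℕ → Measure ℕ} {ρ : Measure ℕ}
    (h : ∀ m, Tendsto (fun n => ν n {m}) atTop (nhds (ρ {m}))) (S : Set ℕ) :
    ρ S ≤ liminf (fun n => ν n S) atTop := by
  have hS : ∀ μ : Measure ℕ, μ S = ∫⁻ m, S.indicator (fun m => μ {m}) m ∂Measure.count := by
    intro μ
    rw [lintegral_count, Measure.tsum_indicator_apply_singleton μ S (MeasurableSet.of_discrete)]
  simp only [hS]
  refine le_trans (lintegral_mono fun m => ?_)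
    (lintegral_liminf_le fun n => measurable_of_countable _)
  refine le_of_eq (Tendsto.liminf_eq ?_).symm
  by_cases hm : m ∈ S
  · simpa [hm] using h m
  · simp [hm]

theorem integral_ewensMeasure {θ : ℝ} (hθ : 0 < θ) (N : ℕ) (f : Equiv.Perm (Fin N) → ℝ) :
    ∫ e, f e ∂(ewensMeasure θ N) = ewensExp θ f := by
  have := isProbabilityMeasure_ewensMeasure hθ N
  rw [integral_fintype (.of_finite), ewensExp]
  refine Finset.sum_congr rfl fun e _ => ?_
  rw [measureReal_def, ewensMeasure_singleton, ENNReal.toReal_ofReal (ewensWeight_nonneg hθ e),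
    smul_eq_mul]

theorem integral_pow_poissonMeasure (r : NNReal) (z : ℝ) :
    ∫ k, z ^ k ∂(poissonMeasure r) = Real.exp (r * (z - 1)) := by
  rw [integral_poissonMeasure]
  have h := (NormedSpace.expSeries_div_hasSum_exp ((r : ℝ) * z)).mul_left (Real.exp (-r))
  rw [← Real.exp_eq_exp_ℝ, ← Real.exp_add] at h
  rw [show (r : ℝ) * (z - 1) = -r + r * z by ring, ← h.tsum_eq]
  refine tsum_congr fun k => ?_
  rw [smul_eq_mul, mul_pow]
  ring

end Ewens

/-! ### Conclusion -/

theorem theorem6p2 (θ : ℝ) (hθ : 0 < θ)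
    {Ω : ℕ → Type*} [∀ N, MeasurableSpace (Ω N)]
    (P : ∀ N, Measure (Ω N)) [∀ N, IsProbabilityMeasure (P N)]
    (σ : ∀ N, Ω N → Equiv.Perm (Fin N))
    (hσ : ∀ N, HasLaw (σ N) (Ewens.ewensMeasure θ N) (P N)) :
    TendstoInDistribution
      (fun (N : ℕ) (ω : Ω N) => (Ewens.numAdjacencies (σ N ω) : ℝ)) atTop
      (fun n : ℕ => (n : ℝ)) P (poissonMeasure 2) := by
  have hmeas : ∀ N, AEMeasurable (fun ω => Ewens.numAdjacencies (σ N ω)) (P N) := fun N =>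
    (Measurable.of_discrete (f := fun e : Equiv.Perm (Fin N) =>
      Ewens.numAdjacencies e)).comp_aemeasurable (hσ N).aemeasurable
  have hprob : ∀ N, IsProbabilityMeasure
      ((P N).map (fun ω => Ewens.numAdjacencies (σ N ω))) := fun N =>
    Measure.isProbabilityMeasure_map (hmeas N)
  have hpgf : ∀ z : ℝ, 0 ≤ z → z ≤ 1 →
      Tendsto (fun N => ∫ k, z ^ k ∂((P N).map (fun ω => Ewens.numAdjacencies (σ N ω)))) atTop
        (nhds (∫ k, z ^ k ∂(poissonMeasure 2))) := by
    intro z h0 h1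
    rw [Ewens.integral_pow_poissonMeasure]
    refine (Ewens.tendsto_ewensExp_pow_numAdjacencies hθ h0 h1).congr fun N => ?_
    rw [integral_map (hmeas N) (by fun_prop), ← Ewens.integral_ewensMeasure hθ, ← (hσ N).map_eq,
      integral_map (hσ N).aemeasurable (by fun_prop)]
  have hsing : ∀ m, Tendsto
      (fun N => ((P N).map (fun ω => Ewens.numAdjacencies (σ N ω))) {m}) atTop
      (nhds (poissonMeasure 2 {m})) := fun m =>
    (ENNReal.tendsto_toReal_iff (fun _ => measure_ne_top _ _) (measure_ne_top _ _)).1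
      (Ewens.tendsto_measureReal_singleton hpgf m)
  -- Convergence is proved in ℕ, where the open-set criterion meets the Fatou bound, and is carried
  -- to ℝ by the continuous inclusion.
  have hnat : TendstoInDistribution
      (fun (N : ℕ) (ω : Ω N) => Ewens.numAdjacencies (σ N ω)) atTop (fun n : ℕ => n) P
      (poissonMeasure 2) :=
    { forall_aemeasurable := hmeas
      aemeasurable_limit := aemeasurable_id
      tendsto := by
        refine tendsto_of_forall_isOpen_le_liminf' fun G _ => ?_
        change (poissonMeasure 2).map id G ≤ _
        rw [Measure.map_id]
        exact Ewens.measure_le_liminf_of_tendsto_singleton hsing G }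
  exact hnat.continuous_comp (g := fun n : ℕ => (n : ℝ)) continuous_of_discreteTopology
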